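/- Let $G$ be a finite graph (not necessarily planar; loops and parallel edges are allowed), let $Q$ be a set of vertices, called terminals, and let $r : Q \to \{2,3\}$ be a requirement function. Say that a graph is $(Q,r)$-vertex-connected if it contains every vertex of $Q$ and any two distinct terminals $x,y \in Q$ are joined in it by $\min\{r(x),r(y)\}$ pairwise internally vertex-disjoint paths (the paths being pairwise edge-disjoint as well, so that parallel edges between $x$ and $y$ count as different paths but one edge counts only once). Suppose that $G$ is a minimal $(Q,r)$-vertex-connected graph, i.e. $G$ is $(Q,r)$-vertex-connected, but no graph obtained from $G$ by deleting a single edge, or a single vertex together with its incident edges, is $(Q,r)$-vertex-connected. Then every cycle of $G$ contains a vertex of $Q$. -/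

import Mathlib

namespace Graph

variable {α β : Type*}

/-- `G.IsWalkFrom x w y`: in the multigraph `G`, the list `w = [(e₁, v₁), …, (eₙ, vₙ)]` is a walk
from `x` to `y`, i.e. `e₁` joins `x` to `v₁`, `e₂` joins `v₁` to `v₂`, …, and `vₙ = y`
(for `n = 0`, `x = y` is a vertex of `G`). -/
def IsWalkFrom (G : Graph α β) : α → List (β × α) → α → Prop
  | x, [], y => x = y ∧ x ∈ G.vertexSet
  | x, (e, v) :: w, y => G.IsLink e x v ∧ G.IsWalkFrom v w y

/-- The vertices visited by the walk `w` starting at `x`, in order, including both ends. -/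
def walkVertices (x : α) (w : List (β × α)) : List α := x :: w.map Prod.snd

/-- The edges traversed by the walk `w`, in order. -/
def walkEdges (w : List (β × α)) : List β := w.map Prod.fst

/-- `w` is a path from `x` to `y` in `G`: a walk without repeated vertices. -/
def IsPathFrom (G : Graph α β) (x : α) (w : List (β × α)) (y : α) : Prop :=
  G.IsWalkFrom x w y ∧ (walkVertices x w).Nodup

/-- `w` is a cycle of `G` through `x`: a nonempty closed walk from `x` to `x` that repeats no edge
and no vertex (except that it returns to `x` at its end). A loop is a cycle of length one, and a
pair of parallel edges is a cycle of length two. -/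
def IsCycleFrom (G : Graph α β) (x : α) (w : List (β × α)) : Prop :=
  G.IsWalkFrom x w x ∧ w ≠ [] ∧ (walkEdges w).Nodup ∧ (w.map Prod.snd).Nodup

/-- Two paths `w₁`, `w₂` from `x` to `y` are internally disjoint: they share no vertex other than
their ends, and no edge. (The second condition only excludes using one edge between `x` and `y`
as two paths; distinct parallel edges between `x` and `y` are internally disjoint paths.) -/
def InternallyDisjoint (x y : α) (w₁ w₂ : List (β × α)) : Prop :=
  (∀ v, v ∈ walkVertices x w₁ → v ∈ walkVertices x w₂ → v = x ∨ v = y) ∧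
    List.Disjoint (walkEdges w₁) (walkEdges w₂)

/-- `x` and `y` are `k`-vertex-connected in `G`: there are `k` pairwise internally disjoint
paths from `x` to `y`. -/
def VertexConnected (G : Graph α β) (k : ℕ) (x y : α) : Prop :=
  ∃ P : Fin k → List (β × α), (∀ i, G.IsPathFrom x (P i) y) ∧
    ∀ i j, i ≠ j → InternallyDisjoint x y (P i) (P j)

/-- `G` is `(Q, r)`-vertex-connected: it contains all the terminals (the elements of `Q`), and any
two distinct terminals `x`, `y` are `min (r x) (r y)`-vertex-connected in `G`. -/
def IsVertexConnectedFor (G : Graph α β) (Q : Set α) (r : Q → ℕ) : Prop :=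
  Q ⊆ G.vertexSet ∧ ∀ x y : Q, x ≠ y → G.VertexConnected (min (r x) (r y)) x y

/-- `G` is a minimal `(Q, r)`-vertex-connected graph: deleting any edge or any vertex violates
the requirement. -/
def IsMinimalVertexConnectedFor (G : Graph α β) (Q : Set α) (r : Q → ℕ) : Prop :=
  G.IsVertexConnectedFor Q r ∧
    (∀ e ∈ G.edgeSet, ¬ (G.deleteEdges {e}).IsVertexConnectedFor Q r) ∧
    ∀ v ∈ G.vertexSet, ¬ (G.deleteVerts {v}).IsVertexConnectedFor Q r

end Graph

/-! Suppose that a cycle C contains no terminal. The argument takes place in the bipartite incidence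
graph, whose vertices are the vertices and the edges of G, so that a cut mixing vertices and edges
is simply a vertex separation. By Menger's theorem, criticality of an edge e of C yields a tight
separation with e in its separator: of order 2 and splitting the terminals, or of order 3 and
splitting the terminals of requirement 3 (`exists_tight`). Everything needed from G is collected in
`CriticalCycle`; the contradiction is `CriticalCycle.notMem_edges`.

The tool is uncrossing: the separations at two opposite corners of s and t have orders adding up to
those of s and t (`order_inf_add_order_sup`). The cycle assists in two ways. A tight separator
containing an edge of C meets C a second time (`exists_mem_sep`), which leaves little room for
terminals in it. Two edges of C in a separator with a common end v on one side can be exchanged for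
v, which is no terminal, so that the order drops (`notMem_sep_of_adj`).

Three contradictions follow, each by minimality of a side. Tight separations of order 2 do not occur
at edges of C (`not_order_two`, `critical_three`). In a separation of order 3 at an edge of C,
neither side has just one terminal of requirement 3 (`not_unique`). Hence each side has such a
terminal outside the separator of any other separation of this kind. Uncrossing a separation at e
whose side is smallest with one at the next edge of C then gives either a smaller side, or a
separator holding two consecutive edges, which can be exchanged for their common end. -/

/-- A separation of a finite graph: two disjoint vertex sets without edges between them. -/
structure VertexSeparation {V : Type*} (H : SimpleGraph V) where
  left : Finset V
  right : Finset V
  disj : ∀ x ∈ left, x ∉ right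
  not_adj : ∀ x ∈ left, ∀ y ∈ right, ¬ H.Adj x y

/-! ### Corners of separations and the modularity of the order -/

namespace VertexSeparation

open Finset

variable {V : Type*} {H : SimpleGraph V}

lemma not_adj' (s : VertexSeparation H) {x y : V} (hx : x ∈ s.left) (hy : y ∈ s.right) :
    ¬ H.Adj y x := fun h => s.not_adj x hx y hy h.symm

/-- The separation with the sides exchanged. -/
@[simps] def swap (s : VertexSeparation H) : VertexSeparation H where
  left := s.right
  right := s.left
  disj x hx hx' := s.disj x hx' hx
  not_adj x hx y hy h := s.not_adj y hy x hx h.symm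

/-- The separation `s` separates elements of `X`. -/
def Splits (s : VertexSeparation H) (X : Set V) : Prop :=
  (∃ x ∈ s.left, x ∈ X) ∧ ∃ x ∈ s.right, x ∈ X

lemma Splits.swap {s : VertexSeparation H} {X : Set V} (h : s.Splits X) : s.swap.Splits X :=
  ⟨h.2, h.1⟩

variable [Fintype V] [DecidableEq V]

/-- The separator: the vertices outside both sides. -/
def sep (s : VertexSeparation H) : Finset V := (s.left ∪ s.right)ᶜ

/-- The order of a separation is the size of its separator. -/
def order (s : VertexSeparation H) : ℕ := #s.sep

@[simp] lemma mem_sep {s : VertexSeparation H} {z : V} :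
    z ∈ s.sep ↔ z ∉ s.left ∧ z ∉ s.right := by
  simp [sep]

@[simp] lemma swap_sep (s : VertexSeparation H) : s.swap.sep = s.sep := by
  simp [sep, union_comm]

@[simp] lemma swap_order (s : VertexSeparation H) : s.swap.order = s.order := by
  simp [order]

/-- The corner separation cutting off the intersection of the left sides. -/
@[simps] def inf (s t : VertexSeparation H) : VertexSeparation H where
  left := s.left ∩ t.left
  right := s.right ∪ t.right
  disj x hx hx' := by
    have := s.disj x; have := t.disj x; grind
  not_adj x hx y hy := by
    have := s.not_adj x; have := t.not_adj x; grind

/-- The corner separation cutting off the intersection of the right sides. -/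
@[simps] def sup (s t : VertexSeparation H) : VertexSeparation H where
  left := s.left ∪ t.left
  right := s.right ∩ t.right
  disj x hx hx' := by
    have := s.disj x; have := t.disj x; grind
  not_adj x hx y hy := by
    have := s.not_adj x; have := t.not_adj x; grind

lemma order_add (s : VertexSeparation H) :
    s.order + #s.left + #s.right = Fintype.card V := by
  have h : Disjoint s.left s.right := Finset.disjoint_left.2 s.disj
  rw [order, sep, card_compl, card_union_of_disjoint h]
  have := card_le_univ (s.left ∪ s.right)
  rw [card_union_of_disjoint h] at this
  omega

/-- By `order_add`, the order is the number of all vertices minus the sizes of the two sides. Each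
corner takes the intersection on one side and the union on the other, so the side sizes add up
exactly. -/
lemma order_inf_add_order_sup (s t : VertexSeparation H) :
    (s.inf t).order + (s.sup t).order = s.order + t.order := by
  have h1 := order_add s
  have h2 := order_add t
  have h3 := order_add (s.inf t)
  have h4 := order_add (s.sup t)
  have h5 := card_union_add_card_inter s.left t.left
  have h6 := card_union_add_card_inter s.right t.right
  simp only [inf_left, inf_right, sup_left, sup_right] at h3 h4
  omega

lemma order_le_card {s : VertexSeparation H} {X : Finset V} (h : ∀ z ∈ s.sep, z ∈ X) :
    s.order ≤ #X := card_le_card h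

/-- Moving a separator vertex without neighbours on the left to the right side. -/
@[simps] def insertRight (s : VertexSeparation H) (z : V) (hz : z ∉ s.left)
    (h : ∀ x ∈ s.left, ¬ H.Adj z x) : VertexSeparation H where
  left := s.left
  right := insert z s.right
  disj x hx hx' := by
    have := s.disj x hx; grind
  not_adj x hx y hy hxy := by
    have := s.not_adj x hx y; have := hxy.symm; grind

lemma order_insertRight_lt (s : VertexSeparation H) {z : V} (hz : z ∈ s.sep)
    (h : ∀ x ∈ s.left, ¬ H.Adj z x) :
    (s.insertRight z (mem_sep.1 hz).1 h).order < s.order := by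
  apply card_lt_card
  rw [ssubset_iff_of_subset]
  · exact ⟨z, hz, by simp⟩
  · intro y
    simp only [mem_sep, insertRight_left, insertRight_right]
    grind

/-- In a separation whose order is smallest among those that split `X`, each vertex of the
separator has a neighbour on the left. -/
lemma exists_adj_left {X : Set V} {k : ℕ} (hk : ∀ t : VertexSeparation H, t.Splits X → k ≤ t.order)
    {s : VertexSeparation H} (hs : s.Splits X) (ho : s.order = k) {z : V} (hz : z ∈ s.sep) :
    ∃ x ∈ s.left, H.Adj z x := by
  by_contra! h
  have h1 := s.order_insertRight_lt hz h
  have h2 := hk (s.insertRight z (mem_sep.1 hz).1 h)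
    ⟨hs.1, by obtain ⟨x, hx, hx'⟩ := hs.2; exact ⟨x, by simp [hx], hx'⟩⟩
  omega

lemma exists_adj_right {X : Set V} {k : ℕ} (hk : ∀ t : VertexSeparation H, t.Splits X → k ≤ t.order)
    {s : VertexSeparation H} (hs : s.Splits X) (ho : s.order = k) {z : V} (hz : z ∈ s.sep) :
    ∃ x ∈ s.right, H.Adj z x :=
  exists_adj_left (s := s.swap) hk hs.swap (by simpa using ho) (by simpa using hz)

end VertexSeparation

/-! ### Critical cycles in the incidence graph -/

/-- A cycle `C` of critical vertices avoiding the terminals `T`, in the incidence graph `H` of a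
graph with edge set `E`, where the terminals are pairwise 2-connected and those in `T₃` are pairwise
3-connected. -/
structure CriticalCycle {V : Type*} [Fintype V] [DecidableEq V] (H : SimpleGraph V)
    (E T T₃ C : Set V) : Prop where
  bipartite : ∀ x y, H.Adj x y → (x ∈ E ↔ y ∉ E)
  subset : T₃ ⊆ T
  two_le : ∀ s : VertexSeparation H, s.Splits T → 2 ≤ s.order
  three_le : ∀ s : VertexSeparation H, s.Splits T₃ → 3 ≤ s.order
  avoids : ∀ x ∈ C, x ∉ T
  edge_ends : ∀ e ∈ C, e ∈ E → ∃ u ∈ C, ∃ v ∈ C, ∀ w, H.Adj e w ↔ w = u ∨ w = v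
  exists_next : ∀ v ∈ C, v ∉ E → ∀ e, ∃ f ∈ C, f ≠ e ∧ H.Adj v f
  -- A cycle minus one element is a path; its connectedness is expressed by a crossing of every cut.
  connected : ∀ z ∈ C, ∀ X : Set V, (∃ x ∈ C, x ∈ X ∧ x ≠ z) → (∃ x ∈ C, x ∉ X ∧ x ≠ z) →
    ∃ x ∈ C, ∃ y ∈ C, x ∈ X ∧ x ≠ z ∧ y ∉ X ∧ y ≠ z ∧ H.Adj x y
  critical : ∀ e ∈ C, e ∈ E → ∃ s : VertexSeparation H, e ∈ s.sep ∧
    (s.order = 2 ∧ s.Splits T ∨ s.order = 3 ∧ s.Splits T₃)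

namespace VertexSeparation

open Finset

variable {V : Type*} [Fintype V] [DecidableEq V] {H : SimpleGraph V}

/-- `s` is a smallest separation splitting the terminals, or the terminals of requirement three. -/
def Tight (T T₃ : Set V) (s : VertexSeparation H) : Prop :=
  s.order = 2 ∧ s.Splits T ∨ s.order = 3 ∧ s.Splits T₃

lemma Tight.swap {T T₃ : Set V} {s : VertexSeparation H} (h : s.Tight T T₃) :
    s.swap.Tight T T₃ := by
  simpa [Tight] using h.imp (fun h => ⟨h.1, h.2.swap⟩) (fun h => ⟨h.1, h.2.swap⟩)

end VertexSeparation

namespace CriticalCycle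

open Finset VertexSeparation

variable {V : Type*} [Fintype V] [DecidableEq V] {H : SimpleGraph V} {E T T₃ C : Set V}

lemma exists_adj_left (hC : CriticalCycle H E T T₃ C) {s : VertexSeparation H}
    (hs : s.Tight T T₃) {z : V} (hz : z ∈ s.sep) : ∃ x ∈ s.left, H.Adj z x := by
  rcases hs with hs | hs
  · exact VertexSeparation.exists_adj_left hC.two_le hs.2 hs.1 hz
  · exact VertexSeparation.exists_adj_left hC.three_le hs.2 hs.1 hz

lemma exists_adj_right (hC : CriticalCycle H E T T₃ C) {s : VertexSeparation H}
    (hs : s.Tight T T₃) {z : V} (hz : z ∈ s.sep) : ∃ x ∈ s.right, H.Adj z x :=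
  hC.exists_adj_left (s := s.swap) hs.swap (by simpa using hz)

lemma mem_of_adj (hC : CriticalCycle H E T T₃ C) {e x : V} (he : e ∈ C) (heE : e ∈ E)
    (h : H.Adj e x) : x ∈ C := by
  obtain ⟨u, hu, v, hv, h'⟩ := hC.edge_ends e he heE
  rcases (h' x).1 h with rfl | rfl <;> assumption

lemma eq_or_eq_of_adj (hC : CriticalCycle H E T T₃ C) {e x y z : V} (he : e ∈ C) (heE : e ∈ E)
    (hx : H.Adj e x) (hy : H.Adj e y) (hxy : x ≠ y) (hz : H.Adj e z) : z = x ∨ z = y := by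
  obtain ⟨u, hu, v, hv, h'⟩ := hC.edge_ends e he heE
  have := (h' x).1 hx
  have := (h' y).1 hy
  have := (h' z).1 hz
  grind

lemma notMem_of_adj (hC : CriticalCycle H E T T₃ C) {e x : V} (heE : e ∈ E)
    (h : H.Adj e x) : x ∉ E := (hC.bipartite _ _ h).1 heE

lemma mem_of_adj' (hC : CriticalCycle H E T T₃ C) {v x : V} (hv : v ∉ E)
    (h : H.Adj v x) : x ∈ E := by
  have := hC.bipartite _ _ h; tauto

/-- An edge of the cycle in the separator of a tight separation has exactly one end on each side,
and so the cycle passes through another vertex of the separator. -/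
lemma exists_mem_sep (hC : CriticalCycle H E T T₃ C) {s : VertexSeparation H}
    (hs : s.Tight T T₃) {e : V} (he : e ∈ s.sep) (heC : e ∈ C) (heE : e ∈ E) :
    ∃ z ∈ s.sep, z ∈ C ∧ z ≠ e ∧ ∃ x ∈ s.left, x ∈ C ∧ H.Adj z x := by
  obtain ⟨u, hu, heu⟩ := hC.exists_adj_left hs he
  obtain ⟨v, hv, hev⟩ := hC.exists_adj_right hs he
  have hd := s.disj
  obtain ⟨x, hx, y, hy, hxl, hxe, hyl, hye, hxy⟩ := hC.connected e heC s.left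
    ⟨u, hC.mem_of_adj heC heE heu, hu, heu.ne'⟩
    ⟨v, hC.mem_of_adj heC heE hev, fun h => hd _ h hv, hev.ne'⟩
  refine ⟨y, ?_, hy, hye, x, hxl, hx, hxy.symm⟩
  rw [mem_sep]
  exact ⟨hyl, fun h => s.not_adj x hxl y h hxy⟩

/-- If two edges of the separator share an end, this end can replace them. -/
lemma notMem_sep_of_adj (hC : CriticalCycle H E T T₃ C) {X : Set V} {k : ℕ} (hX : X ⊆ T)
    (hk : ∀ t : VertexSeparation H, t.Splits X → k ≤ t.order) {s : VertexSeparation H}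
    (hs : s.Tight T T₃) (ho : s.order = k) (hsX : s.Splits X)
    {e f v : V} (he : e ∈ s.sep) (heC : e ∈ C) (heE : e ∈ E) (hv : v ∈ s.left)
    (hev : H.Adj e v) (hfC : f ∈ C) (hef : f ≠ e) (hfv : H.Adj f v) : f ∉ s.sep := by
  intro hf
  have hvE := hC.notMem_of_adj heE hev
  have hfE := hC.mem_of_adj' hvE hfv.symm
  have hvC := hC.mem_of_adj heC heE hev
  -- An edge of the separator has its second end on the right, so `v` is its only neighbour on the
  -- left.
  have key : ∀ e ∈ s.sep, e ∈ C → e ∈ E → H.Adj e v → ∀ x ∈ s.left, H.Adj e x → x = v := by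
    intro e he heC heE hev x hx hex
    obtain ⟨y, hy, hey⟩ := hC.exists_adj_right hs he
    have hd := s.disj
    rcases hC.eq_or_eq_of_adj heC heE hev hey (by grind) hex with h | h
    · exact h
    · grind
  let t : VertexSeparation H :=
    { left := s.left.erase v
      right := s.right ∪ {e, f}
      disj := by
        have hd := s.disj
        simp only [mem_sep] at he hf
        grind
      not_adj := by
        intro x hx y hy hxy
        have h1 := s.not_adj x
        have h2 := key e he heC heE hev x
        have h3 := key f hf hfC hfE hfv x
        have := hxy.symm
        grind }
  have h1 : k ≤ t.order := by
    apply hk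
    obtain ⟨⟨x, hx, hx'⟩, y, hy, hy'⟩ := hsX
    refine ⟨⟨x, ?_, hx'⟩, y, ?_, hy'⟩
    · have := hC.avoids v hvC
      simp only [t, mem_erase]
      exact ⟨fun h => this (h ▸ hX hx'), hx⟩
    · simp [t, hy]
  have h2 : t.order ≤ #(insert v ((s.sep.erase e).erase f)) := by
    apply order_le_card
    intro z hz
    simp only [t, mem_sep] at hz
    simp only [mem_insert, mem_erase, mem_sep]
    grind
  have h3 := card_insert_le v ((s.sep.erase e).erase f)
  rw [card_erase_of_mem (by simpa [hef] using hf), card_erase_of_mem he] at h3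
  have h4 : 2 ≤ #s.sep := by
    have : ({e, f} : Finset V) ⊆ s.sep := by grind
    simpa [card_pair hef.symm] using card_le_card this
  have h5 : #s.sep = k := ho
  omega

/-! ### Excluding tight separations of order two -/

/-- No separation of order two splits both the terminals and the cycle. -/
lemma not_order_two (hC : CriticalCycle H E T T₃ C) (n : ℕ) :
    ∀ s : VertexSeparation H, #s.right = n → s.order = 2 → s.Splits T → (∀ z ∈ s.sep, z ∈ C) →
      (∃ x ∈ s.right, x ∈ C) → ¬ ∀ x ∈ s.right, x ∉ T₃ := by
  induction n using Nat.strong_induction_on with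
  | _ n ih =>
  intro s hn ho hs hsC ⟨b, hb, hbC⟩ hs3
  have hst : s.Tight T T₃ := Or.inl ⟨ho, hs⟩
  have hd := s.disj
  -- an edge of the cycle on the right
  obtain ⟨e, heB, heC, heE⟩ : ∃ e ∈ s.right, e ∈ C ∧ e ∈ E := by
    by_contra! hcon
    have hbE := hcon b hb hbC
    obtain ⟨e, heC, heb, hbe⟩ := hC.exists_next b hbC hbE b
    obtain ⟨f, hfC, hfe, hbf⟩ := hC.exists_next b hbC hbE e
    have heE := hC.mem_of_adj' hbE hbe
    have hfE := hC.mem_of_adj' hbE hbf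
    have hes : e ∈ s.sep := by
      have := s.not_adj e; have := hcon e; have := hbe.symm
      simp only [mem_sep]; grind
    have hfs : f ∈ s.sep := by
      have := s.not_adj f; have := hcon f; have := hbf.symm
      simp only [mem_sep]; grind
    exact hC.notMem_sep_of_adj subset_rfl hC.two_le hst.swap (by simpa using ho) hs.swap
      (by simpa using hes) heC heE hb hbe.symm hfC hfe hbf.symm (by simpa using hfs)
  -- a smaller separation containing `e`
  have small : ∀ t : VertexSeparation H, t.right ⊆ s.right → e ∈ t.sep → t.order ≤ 2 →
      t.Splits T → False := by
    intro t hts het hto htT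
    have hto : t.order = 2 := le_antisymm hto (hC.two_le t htT)
    have htt : t.Tight T T₃ := Or.inl ⟨hto, htT⟩
    obtain ⟨z, hz, hzC, hze, -⟩ := hC.exists_mem_sep htt het heC heE
    obtain ⟨x, hx, hex⟩ := hC.exists_adj_right htt het
    refine ih #t.right ?_ t rfl hto htT ?_ ⟨x, hx, hC.mem_of_adj heC heE hex⟩
      (fun x hx => hs3 x (hts hx))
    · rw [← hn]
      apply card_lt_card
      rw [ssubset_iff_of_subset hts]
      exact ⟨e, heB, (mem_sep.1 het).2⟩
    · have : {e, z} = t.sep := by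
        apply eq_of_subset_of_card_le
        · grind
        · rw [card_pair hze.symm]; exact hto.le
      intro y hy
      rw [← this] at hy
      grind
  obtain ⟨t, het, ht⟩ := hC.critical e heC heE
  have hd' := t.disj
  have het' := mem_sep.1 het
  rcases ht with ⟨hto, htT⟩ | ⟨hto, htT⟩
  · obtain ⟨z, hz, hzC, hze, -⟩ := hC.exists_mem_sep (Or.inl ⟨hto, htT⟩) het heC heE
    have htC : ∀ y ∈ t.sep, y ∈ C := by
      have : {e, z} = t.sep := by
        apply eq_of_subset_of_card_le
        · grind
        · rw [card_pair hze.symm]; exact hto.le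
      intro y hy
      rw [← this] at hy
      grind
    -- If two opposite corners contain terminals, both corner separations have order at least 2. The
    -- orders sum to 4, so the corner inside `s.right` gives a smaller separation at `e`.
    have cross : ∀ t : VertexSeparation H, e ∈ t.sep → t.order = 2 →
        (∃ x ∈ s.right ∩ t.right, x ∈ T) → (∃ x ∈ s.left ∩ t.left, x ∈ T) → False := by
      rintro t het hto ⟨x, hx, hxT⟩ ⟨y, hy, hyT⟩
      have h1 := hC.two_le (s.inf t)
        ⟨⟨y, hy, hyT⟩, x, by simp only [inf_right]; grind, hxT⟩
      have h2 := order_inf_add_order_sup s t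
      refine small (s.sup t) inter_subset_left ?_ (by omega)
        ⟨⟨y, by simp only [sup_left]; grind, hyT⟩, x, hx, hxT⟩
      simp only [mem_sep, sup_left, sup_right] at het ⊢
      grind
    have c1 : ∀ x y, x ∈ s.right → x ∈ t.right → x ∈ T → y ∈ s.left → y ∈ t.left → y ∉ T :=
      fun x y h1 h2 h3 h4 h5 h6 =>
        cross t het hto ⟨x, mem_inter.2 ⟨h1, h2⟩, h3⟩ ⟨y, mem_inter.2 ⟨h4, h5⟩, h6⟩
    have c2 : ∀ x y, x ∈ s.right → x ∈ t.left → x ∈ T → y ∈ s.left → y ∈ t.right → y ∉ T :=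
      fun x y h1 h2 h3 h4 h5 h6 => cross t.swap (by simpa using het) (by simpa using hto)
        ⟨x, mem_inter.2 ⟨h1, h2⟩, h3⟩ ⟨y, mem_inter.2 ⟨h4, h5⟩, h6⟩
    obtain ⟨⟨a, ha, haT⟩, b', hb', hbT⟩ := hs
    obtain ⟨⟨a', ha', haT'⟩, b'', hb'', hbT'⟩ := htT
    have ns : ∀ x ∈ T, x ∈ s.left ∨ x ∈ s.right := by
      intro x hx; by_contra! h
      exact hC.avoids x (hsC x (mem_sep.2 h)) hx
    have nt : ∀ x ∈ T, x ∈ t.left ∨ x ∈ t.right := by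
      intro x hx; by_contra! h
      exact hC.avoids x (htC x (mem_sep.2 h)) hx
    -- Both separators lie in the cycle, so every terminal lies in a corner. As each of the four
    -- sides has a terminal, some two opposite corners both have one.
    clear ih small cross htC hsC
    have := ns a' haT'
    have := ns b'' hbT'
    have := nt a haT
    have := nt b' hbT
    grind
  · obtain ⟨⟨x, hx, hxT⟩, y, hy, hyT⟩ := htT
    have ns : ∀ x ∈ T₃, x ∈ s.left := by
      intro x hx; by_contra! h
      exact hC.avoids x (hsC x (mem_sep.2 ⟨h, fun h' => hs3 x h' hx⟩)) (hC.subset hx)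
    have hxs := ns x hxT
    have hys := ns y hyT
    -- All of `T₃` lies in `s.left` and is split by `t`, so both corners in `s.left` have order at
    -- least 3. The opposite corners, in `s.right`, are then left with order at most 2 + 3 - 3 = 2.
    have o1 := hC.three_le (s.inf t)
      ⟨⟨x, by simp [hx, hxs], hxT⟩, y, by simp [hy], hyT⟩
    have o2 := hC.three_le (s.inf t.swap)
      ⟨⟨y, by simp [hy, hys], hyT⟩, x, by simp [hx], hxT⟩
    have o3 := order_inf_add_order_sup s t
    have o4 := order_inf_add_order_sup s t.swap
    rw [swap_order] at o4
    have e1 : e ∈ (s.sup t).sep := by simp only [mem_sep, sup_left, sup_right]; grind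
    have e2 : e ∈ (s.sup t.swap).sep := by
      simp only [mem_sep, sup_left, sup_right, swap_left, swap_right]; grind
    obtain ⟨⟨a, ha, haT⟩, z, hz, hzT⟩ := hs
    by_cases z1 : z ∈ t.right
    · exact small (s.sup t) inter_subset_left e1 (by omega)
        ⟨⟨a, by simp [ha], haT⟩, z, by simp [hz, z1], hzT⟩
    by_cases z2 : z ∈ t.left
    · exact small (s.sup t.swap) inter_subset_left e2 (by omega)
        ⟨⟨a, by simp [ha], haT⟩, z, by simp [hz, z2], hzT⟩
    have hez : e ≠ z := fun h => hC.avoids e heC (h ▸ hzT)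
    have s1 : {e, z} = (s.sup t).sep := by
      apply eq_of_subset_of_card_le
      · simp only [insert_subset_iff, e1, true_and, singleton_subset_iff, mem_sep, sup_left,
          sup_right]
        grind
      · rw [card_pair hez]; change (s.sup t).order ≤ 2; omega
    have s2 : {e, z} = (s.sup t.swap).sep := by
      apply eq_of_subset_of_card_le
      · simp only [insert_subset_iff, e2, true_and, singleton_subset_iff, mem_sep, sup_left,
          sup_right, swap_left, swap_right]
        grind
      · rw [card_pair hez]; change (s.sup t.swap).order ≤ 2; omega
    -- Both corner separators equal `{e, z}`, a subset of `s.right`. An element of `s.sep` belongs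
    -- to neither, so it would have to lie in both `t.left` and `t.right`.
    obtain ⟨w, hw⟩ : s.sep.Nonempty := by
      rw [← card_pos]; change 0 < s.order; omega
    have w1 := Finset.ext_iff.1 s1 w
    have w2 := Finset.ext_iff.1 s2 w
    have w3 := hd' w
    simp only [mem_sep, sup_left, sup_right, swap_left, swap_right] at w1 w2 hw
    grind

/-- Each edge of the cycle is critical for the requirement three. -/
lemma critical_three (hC : CriticalCycle H E T T₃ C) {e : V} (heC : e ∈ C) (heE : e ∈ E) :
    ∃ s : VertexSeparation H, e ∈ s.sep ∧ s.order = 3 ∧ s.Splits T₃ := by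
  obtain ⟨s, he, ⟨ho, hs⟩ | h⟩ := hC.critical e heC heE
  · exfalso
    have hst : s.Tight T T₃ := Or.inl ⟨ho, hs⟩
    obtain ⟨z, hz, hzC, hze, -⟩ := hC.exists_mem_sep hst he heC heE
    have hsC : ∀ y ∈ s.sep, y ∈ C := by
      have : {e, z} = s.sep := by
        apply eq_of_subset_of_card_le
        · grind
        · rw [card_pair hze.symm]; exact ho.le
      intro y hy
      rw [← this] at hy
      grind
    obtain ⟨x, hx, hex⟩ := hC.exists_adj_left hst he
    obtain ⟨y, hy, hey⟩ := hC.exists_adj_right hst he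
    -- Both sides contain terminals of requirement three, which two elements cannot separate.
    have h1 := hC.not_order_two _ s rfl ho hs hsC ⟨y, hy, hC.mem_of_adj heC heE hey⟩
    have h2 := hC.not_order_two _ s.swap rfl (by simpa using ho) hs.swap (by simpa using hsC)
      ⟨x, hx, hC.mem_of_adj heC heE hex⟩
    push Not at h1 h2
    obtain ⟨b, hb, hb3⟩ := h1
    obtain ⟨a, ha, ha3⟩ := h2
    have := hC.three_le s ⟨⟨a, ha, ha3⟩, b, hb, hb3⟩
    omega
  · exact ⟨s, he, h⟩

end CriticalCycle

/-! ### Sides with a single terminal of requirement three -/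

namespace VertexSeparation

open Finset

variable {V : Type*} [Fintype V] [DecidableEq V] {H : SimpleGraph V}

lemma card_sep_inter (s t : VertexSeparation H) :
    #(s.sep ∩ t.left) + #(s.sep ∩ t.right) + #(s.sep ∩ t.sep) = s.order := by
  have hd := t.disj
  rw [← card_union_of_disjoint, ← card_union_of_disjoint, order]
  · congr 1
    ext x
    simp only [mem_union, mem_inter, mem_sep]
    grind
  · rw [Finset.disjoint_left]
    intro x
    simp only [mem_union, mem_inter, mem_sep]
    grind
  · rw [Finset.disjoint_left]
    grind

/-- The separator at a corner consists of the centre and two of the four arms of the crossing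
separators. Together with `card_sep_inter` this reduces uncrossing to arithmetic in five numbers. -/
lemma order_sup (s t : VertexSeparation H) :
    (s.sup t).order = #(s.sep ∩ t.right) + #(s.sep ∩ t.sep) + #(t.sep ∩ s.right) := by
  have hd := t.disj
  have hd' := s.disj
  rw [← card_union_of_disjoint, ← card_union_of_disjoint, order]
  · congr 1
    ext x
    simp only [mem_union, mem_inter, mem_sep, sup_left, sup_right]
    grind
  · rw [Finset.disjoint_left]
    intro x
    simp only [mem_union, mem_inter, mem_sep]
    grind
  · rw [Finset.disjoint_left]
    intro x
    simp only [mem_inter, mem_sep]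
    grind

end VertexSeparation

namespace CriticalCycle

open Finset VertexSeparation

variable {V : Type*} [Fintype V] [DecidableEq V] {H : SimpleGraph V} {E T T₃ C : Set V}

/-- If `q` were in `t.sep`, then `f` and `q` would use up two of its three places. Counting then
leaves the corner of `s.left` and `t.right` with boundary `{f, q, y}`, where `q` and `y` are
terminals. The cycle enters this corner through `f` and has no other way out. -/
lemma not_mem_sep_of_unique (hC : CriticalCycle H E T T₃ C) {s t : VertexSeparation H}
    (hs : s.order = 3) (ht : t.order = 3) (htT : t.Splits T₃) {q z₀ e f : V}
    (hq : q ∈ s.left) (hqT : q ∈ T₃) (hq' : ∀ x ∈ s.left, x ∈ T₃ → x = q)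
    (hz₀ : z₀ ∈ s.right) (hz₀T : z₀ ∈ T₃) (hz₀t : z₀ ∈ t.left)
    (he : e ∈ s.sep) (heC : e ∈ C)
    (hf : f ∈ s.left) (hfC : f ∈ C) (hfE : f ∈ E) (hft : f ∈ t.sep) : q ∉ t.sep := by
  intro hqt
  have hd := s.disj
  have hd' := t.disj
  have htt : t.Tight T T₃ := Or.inr ⟨ht, htT⟩
  have hqC : q ∉ C := fun h => hC.avoids q h (hC.subset hqT)
  have hfq : f ≠ q := by grind
  have k1 := card_sep_inter s t
  have k2 := card_sep_inter t s
  have k3 := order_sup s t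
  have k4 := order_sup s t.swap
  simp only [swap_right, swap_sep] at k4
  rw [inter_comm t.sep s.sep] at k2
  have o4 := hC.three_le (s.sup t.swap)
    ⟨⟨q, by simp [hq], hqT⟩, z₀, by simp [hz₀, hz₀t], hz₀T⟩
  have hfqs : {f, q} ⊆ t.sep ∩ s.left := by
    simp only [insert_subset_iff, singleton_subset_iff, mem_inter]
    tauto
  have hc : 2 ≤ #(t.sep ∩ s.left) := by
    simpa [card_pair hfq] using card_le_card hfqs
  obtain ⟨-, y, hy, hyT⟩ := htT
  have hyC : y ∉ C := fun h => hC.avoids y h (hC.subset hyT)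
  have hyt : y ∉ t.sep := fun h => (mem_sep.1 h).2 hy
  have hyl : y ∉ s.left := fun h => hyt (hq' y h hyT ▸ hqt)
  have hyr : y ∉ s.right := by
    intro h
    have o3 := hC.three_le (s.sup t) ⟨⟨q, by simp [hq], hqT⟩, y, by simp [hy, h], hyT⟩
    omega
  have hys : y ∈ s.sep ∩ t.right := mem_inter.2 ⟨mem_sep.2 ⟨hyl, hyr⟩, hy⟩
  have hb : 0 < #(s.sep ∩ t.right) := card_pos.2 ⟨y, hys⟩
  -- Since `y` takes a place of `s.sep` in `t.right`, the bound `o4` forces `t.sep` to meet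
  -- `s.right`. With `f` and `q` this exhausts `t.sep`, and all counts are determined.
  have hm : s.sep ∩ t.sep = ∅ := card_eq_zero.1 (by omega)
  have hb' : s.sep ∩ t.right = {y} :=
    (eq_of_subset_of_card_le (singleton_subset_iff.2 hys) (by rw [card_singleton]; omega)).symm
  have hc' : {f, q} = t.sep ∩ s.left :=
    eq_of_subset_of_card_le hfqs (by rw [card_pair hfq]; omega)
  obtain ⟨w, hw, hfw⟩ := hC.exists_adj_right htt hft
  have hwC := hC.mem_of_adj hfC hfE hfw
  have hm' : ∀ x ∈ s.sep, x ∉ t.sep := fun x h h' => by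
    have := mem_inter.2 ⟨h, h'⟩; rw [hm] at this; simp at this
  have hb'' : ∀ x ∈ s.sep, x ∈ t.right → x = y := fun x h h' => by
    have := mem_inter.2 ⟨h, h'⟩; rw [hb'] at this; simpa using this
  have hc'' : ∀ x ∈ t.sep, x ∈ s.left → x = f ∨ x = q := fun x h h' => by
    have := mem_inter.2 ⟨h, h'⟩; rw [← hc'] at this; simpa using this
  have hwl : w ∈ s.left := by
    by_contra h
    have h1 := s.not_adj f hf w
    have h2 := hb'' w (mem_sep.2 ⟨h, fun h' => h1 h' hfw⟩) hw
    exact hyC (h2 ▸ hwC)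
  have hel := (mem_sep.1 he).1
  obtain ⟨x, -, y', hy'C, hxX, -, hyX, hyf, hxy⟩ := hC.connected f hfC {x | x ∈ s.left ∧ x ∈ t.right}
    ⟨w, hwC, ⟨hwl, hw⟩, hfw.ne'⟩ ⟨e, heC, fun h => hel h.1, fun h => hel (h ▸ hf)⟩
  have h1 := s.not_adj x hxX.1 y'
  have h2 := t.not_adj' (x := y') (y := x)
  have h3 : y' ∉ s.right := fun h => h1 h hxy
  have h4 : y' ∉ t.left := fun h => h2 h hxX.2 hxy
  by_cases h5 : y' ∈ s.left
  · have h6 : y' ∉ t.right := fun h => hyX ⟨h5, h⟩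
    rcases hc'' y' (mem_sep.2 ⟨h4, h6⟩) h5 with h | h
    · exact hyf h
    · exact hqC (h ▸ hy'C)
  · have h6 := mem_sep.2 ⟨h5, h3⟩
    have h7 := hm' y' h6
    have h8 : y' ∈ t.right := by
      by_contra h; exact h7 (mem_sep.2 ⟨h4, h⟩)
    exact hyC (hb'' y' h6 h8 ▸ hy'C)

/-- By `hmin`, the corner of `q` has order at least 4, so the opposite one has order at most 2 and
contains no terminal of requirement three. Those of `t.right` must then lie in `s.sep`, and counting
leaves room for just one element of `s.sep` outside `t.left`. -/
lemma mem_left_of_unique (hC : CriticalCycle H E T T₃ C) {s t : VertexSeparation H}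
    (hs : s.order = 3) (ht : t.order = 3) (htT : t.Splits T₃) {q z₀ e z f : V}
    (hq : q ∈ s.left) (hqT : q ∈ T₃) (hq' : ∀ x ∈ s.left, x ∈ T₃ → x = q)
    (hz₀ : z₀ ∈ s.right) (hz₀T : z₀ ∈ T₃)
    (he : e ∈ s.sep) (heC : e ∈ C) (hz : z ∈ s.sep) (hzC : z ∈ C)
    (hf : f ∈ s.left) (hfC : f ∈ C) (hfE : f ∈ E) (hft : f ∈ t.sep) (hqt : q ∈ t.left)
    (hmin : ∀ t : VertexSeparation H, t.left ⊂ s.left → t.order = 3 → q ∈ t.left →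
      (∃ x ∈ t.right, x ∈ T₃) → ∀ e ∈ t.sep, e ∈ C → e ∉ E) :
    e ∈ t.left ∧ z ∈ t.left ∧ ∃ p ∈ t.right, p ∈ s.sep ∧ p ∈ T₃ := by
  have hd := s.disj
  have hd' := t.disj
  obtain ⟨-, y, hy, hyT⟩ := htT
  have hyC : y ∉ C := fun h => hC.avoids y h (hC.subset hyT)
  have k1 := card_sep_inter s t
  have k2 := card_sep_inter t s
  have k3 := order_sup s t
  have k4 := order_sup s t.swap
  have k5 := order_inf_add_order_sup s t
  simp only [swap_right, swap_sep] at k4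
  rw [inter_comm t.sep s.sep] at k2
  have o1 := hC.three_le (s.inf t) ⟨⟨q, by simp [hq, hqt], hqT⟩, y, by simp [hy], hyT⟩
  have o2 : (s.inf t).order ≠ 3 := by
    intro ho
    refine hmin (s.inf t) ?_ ho (by simp [hq, hqt]) ⟨y, by simp [hy], hyT⟩ f ?_ hfC hfE
    · rw [inf_left, ssubset_iff_of_subset inter_subset_left]
      have := (mem_sep.1 hft).1
      exact ⟨f, hf, by simp [this]⟩
    · have := mem_sep.1 hft
      simp only [mem_sep, inf_left, inf_right]
      grind
  have hsup : ∀ x ∈ s.right, x ∈ t.right → x ∉ T₃ := by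
    intro x h h' hT
    have := hC.three_le (s.sup t) ⟨⟨q, by simp [hq], hqT⟩, x, by simp [h, h'], hT⟩
    omega
  have hyl : y ∉ s.left := fun h => hd' q hqt (hq' y h hyT ▸ hy)
  have hyr : y ∉ s.right := fun h => hsup y h hy hyT
  have hys : y ∈ s.sep := mem_sep.2 ⟨hyl, hyr⟩
  have hb : 0 < #(s.sep ∩ t.right) := card_pos.2 ⟨y, mem_inter.2 ⟨hys, hy⟩⟩
  -- In either case `t.sep` meets `s.right`: by the order of `s.sup t.swap` if `z₀` is in `t.left`,
  -- and in `z₀` itself otherwise. As `s.sup t` has order at most 2, only `y` fits besides.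
  have hcount : #(s.sep ∩ t.sep) = 0 ∧ #(s.sep ∩ t.right) = 1 := by
    by_cases h : z₀ ∈ t.left
    · have o4 := hC.three_le (s.sup t.swap)
        ⟨⟨q, by simp [hq], hqT⟩, z₀, by simp [hz₀, h], hz₀T⟩
      omega
    · have h' : z₀ ∉ t.right := fun h' => hsup z₀ hz₀ h' hz₀T
      have : 0 < #(t.sep ∩ s.right) := card_pos.2 ⟨z₀, mem_inter.2 ⟨mem_sep.2 ⟨h, h'⟩, hz₀⟩⟩
      omega
  have hm := card_eq_zero.1 hcount.1
  have key : ∀ x ∈ s.sep, x ∈ C → x ∈ t.left := by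
    intro x hx hxC
    by_contra hxl
    by_cases hxr : x ∈ t.right
    · have hxy : x ≠ y := fun h => hyC (h ▸ hxC)
      have : {x, y} ⊆ s.sep ∩ t.right := by
        simp only [insert_subset_iff, singleton_subset_iff, mem_inter]
        tauto
      have := card_le_card this
      rw [card_pair hxy] at this
      omega
    · have : x ∈ s.sep ∩ t.sep := mem_inter.2 ⟨hx, mem_sep.2 ⟨hxl, hxr⟩⟩
      rw [hm] at this
      simp at this
  exact ⟨key e he heC, key z hz hzC, y, hy, hys, hyT⟩

/-- In a smallest side with just one terminal of requirement three, each edge of the cycle lies in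
the separator of a tight separation with the whole cycle part of the old separator on one side. -/
lemma exists_crossing (hC : CriticalCycle H E T T₃ C) {s : VertexSeparation H}
    (hs : s.order = 3) {q z₀ e z f : V}
    (hq : q ∈ s.left) (hqT : q ∈ T₃) (hq' : ∀ x ∈ s.left, x ∈ T₃ → x = q)
    (hz₀ : z₀ ∈ s.right) (hz₀T : z₀ ∈ T₃)
    (he : e ∈ s.sep) (heC : e ∈ C) (hz : z ∈ s.sep) (hzC : z ∈ C)
    (hf : f ∈ s.left) (hfC : f ∈ C) (hfE : f ∈ E)
    (hmin : ∀ t : VertexSeparation H, t.left ⊂ s.left → t.order = 3 → q ∈ t.left →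
      (∃ x ∈ t.right, x ∈ T₃) → ∀ e ∈ t.sep, e ∈ C → e ∉ E) :
    ∃ t : VertexSeparation H, t.order = 3 ∧ t.Splits T₃ ∧ f ∈ t.sep ∧ q ∈ t.left ∧
      e ∈ t.left ∧ z ∈ t.left ∧ ∃ p ∈ t.right, p ∈ s.sep ∧ p ∈ T₃ := by
  obtain ⟨t, hft, ht, htT⟩ := hC.critical_three hfC hfE
  have hft' : f ∈ t.swap.sep := by simpa using hft
  have ht' : t.swap.order = 3 := by simpa using ht
  by_cases h1 : q ∈ t.left
  · exact ⟨t, ht, htT, hft, h1, hC.mem_left_of_unique hs ht htT hq hqT hq' hz₀ hz₀T he heC hz hzC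
      hf hfC hfE hft h1 hmin⟩
  by_cases h2 : q ∈ t.right
  · exact ⟨t.swap, ht', htT.swap, hft', h2, hC.mem_left_of_unique hs ht' htT.swap hq hqT hq'
      hz₀ hz₀T he heC hz hzC hf hfC hfE hft' h2 hmin⟩
  exfalso
  have hqt : q ∈ t.sep := mem_sep.2 ⟨h1, h2⟩
  have hd := s.disj
  have hqC : q ∉ C := fun h => hC.avoids q h (hC.subset hqT)
  have hzC₀ : z₀ ∉ C := fun h => hC.avoids z₀ h (hC.subset hz₀T)
  by_cases h3 : z₀ ∈ t.left
  · exact hC.not_mem_sep_of_unique hs ht htT hq hqT hq' hz₀ hz₀T h3 he heC hf hfC hfE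
      hft hqt
  by_cases h4 : z₀ ∈ t.right
  · exact hC.not_mem_sep_of_unique hs ht' htT.swap hq hqT hq' hz₀ hz₀T h4 he heC hf hfC
      hfE hft' (by simpa using hqt)
  -- With both `q` and `z₀` in `t.sep`, the two elements of the cycle there make four.
  obtain ⟨z', hz', hzC', hzf, -⟩ := hC.exists_mem_sep (Or.inr ⟨ht, htT⟩) hft hfC hfE
  have h5 : ({z₀, q, f, z'} : Finset V) ⊆ t.sep := by
    simp only [insert_subset_iff, singleton_subset_iff, hqt, hft, hz', and_true]
    exact mem_sep.2 ⟨h3, h4⟩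
  have h6 : #({z₀, q, f, z'} : Finset V) = 4 := by
    rw [card_insert_of_notMem, card_insert_of_notMem, card_pair hzf.symm]
    · grind
    · grind
  have h7 := card_le_card h5
  have h8 : #t.sep = 3 := ht
  omega

/-- Both sides of a tight separation of an edge of the cycle have at least two terminals of
requirement three. -/
lemma not_unique (hC : CriticalCycle H E T T₃ C) {q : V} (hqT : q ∈ T₃) (n : ℕ) :
    ∀ s : VertexSeparation H, #s.left = n → s.order = 3 → q ∈ s.left →
      (∃ x ∈ s.right, x ∈ T₃) → (∀ x ∈ s.left, x ∈ T₃ → x = q) → ∀ e ∈ s.sep, e ∈ C → e ∉ E := by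
  induction n using Nat.strong_induction_on with
  | _ n ih =>
  intro s hn hs hq ⟨z₀, hz₀, hz₀T⟩ hq' e he heC heE
  have hsT : s.Splits T₃ := ⟨⟨q, hq, hqT⟩, z₀, hz₀, hz₀T⟩
  have hst : s.Tight T T₃ := Or.inr ⟨hs, hsT⟩
  have hmin : ∀ t : VertexSeparation H, t.left ⊂ s.left → t.order = 3 → q ∈ t.left →
      (∃ x ∈ t.right, x ∈ T₃) → ∀ e ∈ t.sep, e ∈ C → e ∉ E := by
    intro t hts ht hqt htT e he heC
    exact ih _ (hn ▸ card_lt_card hts) t rfl ht hqt htT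
      (fun x hx => hq' x (hts.1 hx)) e he heC
  clear ih
  have hd := s.disj
  have hqC : q ∉ C := fun h => hC.avoids q h (hC.subset hqT)
  obtain ⟨v, hv, hev⟩ := hC.exists_adj_left hst he
  obtain ⟨u, hu, heu⟩ := hC.exists_adj_right hst he
  have hvC := hC.mem_of_adj heC heE hev
  have hvE := hC.notMem_of_adj heE hev
  obtain ⟨z, hz, hzC, hze, w₀, hw₀, hw₀C, hzw₀⟩ := hC.exists_mem_sep hst he heC heE
  -- the second edge of the cycle at a vertex next to the separator
  have next : ∀ e ∈ s.sep, e ∈ C → e ∈ E → ∀ v ∈ s.left, H.Adj e v →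
      ∃ f ∈ s.left, f ∈ C ∧ f ∈ E ∧ H.Adj f v := by
    intro e he heC heE v hv hev
    have hvE := hC.notMem_of_adj heE hev
    obtain ⟨f, hfC, hfe, hvf⟩ := hC.exists_next v (hC.mem_of_adj heC heE hev) hvE e
    have hf := hC.notMem_sep_of_adj hC.subset hC.three_le hst hs hsT he heC heE hv hev hfC hfe
      hvf.symm
    have := s.not_adj v hv f
    refine ⟨f, ?_, hfC, hC.mem_of_adj' hvE hvf, hvf.symm⟩
    by_contra h
    exact hf (mem_sep.2 ⟨h, fun h' => this h' hvf⟩)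
  obtain ⟨f, hf, hfC, hfE, hfv⟩ := next e he heC heE v hv hev
  -- The counterpart at `z` of `v` and `f` at `e`: a vertex `w` of the cycle, which is `z` itself or
  -- the left end of the edge `z`, and an edge `g` of the cycle at `w` inside `s.left`.
  obtain ⟨w, g, hwC, hwE, hg, hgC, hgE, hgw, hvw, hzw⟩ : ∃ w g, w ∈ C ∧ w ∉ E ∧ g ∈ s.left ∧
      g ∈ C ∧ g ∈ E ∧ H.Adj g w ∧ v ≠ w ∧ (z = w ∨ z ∈ E ∧ w ∈ s.left ∧ H.Adj z w) := by
    by_cases hzE : z ∈ E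
    · obtain ⟨g, hg, hgC, hgE, hgw⟩ := next z hz hzC hzE w₀ hw₀ hzw₀
      refine ⟨w₀, g, hw₀C, hC.notMem_of_adj hzE hzw₀, hg, hgC, hgE, hgw, ?_, Or.inr ⟨hzE, hw₀, hzw₀⟩⟩
      rintro rfl
      exact hC.notMem_sep_of_adj hC.subset hC.three_le hst hs hsT he heC heE hv hev hzC hze hzw₀ hz
    · exact ⟨z, w₀, hzC, hzE, hw₀, hw₀C, hC.mem_of_adj' hzE hzw₀, hzw₀.symm,
        fun h => (mem_sep.1 hz).1 (h ▸ hv), Or.inl rfl⟩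
  obtain ⟨s₁, hs₁, hs₁T, hfs₁, hqs₁, hes₁, hzs₁, p, hp₁, hp, hpT⟩ :=
    hC.exists_crossing hs hq hqT hq' hz₀ hz₀T he heC hz hzC hf hfC hfE hmin
  obtain ⟨s₂, hs₂, hs₂T, hgs₂, hqs₂, hes₂, hzs₂, p', hp₂, hp', hpT'⟩ :=
    hC.exists_crossing hs hq hqT hq' hz₀ hz₀T he heC hz hzC hg hgC hgE hmin
  clear next hmin
  have hpC : p ∉ C := fun h => hC.avoids p h (hC.subset hpT)
  have hpC' : p' ∉ C := fun h => hC.avoids p' h (hC.subset hpT')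
  have hS : {e, z, p} = s.sep := by
    apply eq_of_subset_of_card_le
    · simp only [insert_subset_iff, singleton_subset_iff]
      tauto
    · rw [card_insert_of_notMem (by grind), card_pair (by grind)]
      exact hs.le
  obtain rfl : p' = p := by
    rw [← hS] at hp'
    grind
  have hS' : ∀ x, x ∉ s.left → x ∉ s.right → x = e ∨ x = z ∨ x = p' := by
    intro x h1 h2
    have := mem_sep.2 ⟨h1, h2⟩
    rw [← hS] at this
    simpa using this
  -- Combining the separations at `f` and `g` gives one that keeps `q`, `e`, `z` on the left and
  -- `p'` on the right, with neither `f` nor `g` on the left.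
  obtain ⟨U, hU⟩ : ∃ U, U = s₁.inf s₂ := ⟨_, rfl⟩
  have hUl : ∀ x, x ∈ U.left ↔ x ∈ s₁.left ∧ x ∈ s₂.left := by simp [hU]
  have hUr : ∀ x, x ∈ U.right ↔ x ∈ s₁.right ∨ x ∈ s₂.right := by simp [hU]
  have hUo : U.order ≤ 3 := by
    have o1 := order_inf_add_order_sup s₁ s₂
    have o2 := hC.three_le (s₁.sup s₂)
      ⟨⟨q, by simp [hqs₁], hqT⟩, p', by simp [hp₁, hp₂], hpT⟩
    rw [hU]; omega
  have hUd := U.disj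
  have hqU : q ∈ U.left := (hUl q).2 ⟨hqs₁, hqs₂⟩
  have heU : e ∈ U.left := (hUl e).2 ⟨hes₁, hes₂⟩
  have hzU : z ∈ U.left := (hUl z).2 ⟨hzs₁, hzs₂⟩
  have hpU : p' ∈ U.right := (hUr p').2 (Or.inl hp₁)
  -- the separator of `U` meets the left side in at most two vertices
  have hc : #(U.sep ∩ s.left) ≤ 2 := by
    have k1 := card_sep_inter s U
    have k2 := card_sep_inter U s
    have k3 := order_sup s U
    have k4 := order_sup s U.swap
    simp only [swap_right, swap_sep] at k4
    rw [inter_comm U.sep s.sep] at k2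
    have hb : 0 < #(s.sep ∩ U.right) := card_pos.2 ⟨p', mem_inter.2 ⟨hp, hpU⟩⟩
    have ha : 2 ≤ #(s.sep ∩ U.left) := by
      rw [← card_pair hze]
      apply card_le_card
      simp only [insert_subset_iff, singleton_subset_iff, mem_inter]
      tauto
    by_contra! h
    have hd0 : #(U.sep ∩ s.right) = 0 := by omega
    by_cases h1 : z₀ ∈ U.left
    · have := hC.three_le (s.sup U.swap) ⟨⟨q, by simp [hq], hqT⟩, z₀, by simp [hz₀, h1], hz₀T⟩
      omega
    by_cases h2 : z₀ ∈ U.right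
    · have := hC.three_le (s.sup U) ⟨⟨q, by simp [hq], hqT⟩, z₀, by simp [hz₀, h2], hz₀T⟩
      omega
    rw [card_eq_zero] at hd0
    have : z₀ ∈ U.sep ∩ s.right := mem_inter.2 ⟨mem_sep.2 ⟨h1, h2⟩, hz₀⟩
    rw [hd0] at this
    simp at this
  have hfU : f ∉ U.left := fun h => (mem_sep.1 hfs₁).1 ((hUl f).1 h).1
  have hgU : g ∉ U.left := fun h => (mem_sep.1 hgs₂).1 ((hUl g).1 h).2
  have hvU : v ∉ U.right := fun h => U.not_adj e heU v h hev
  have hwU : w ∉ U.right := by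
    rcases hzw with rfl | ⟨-, -, h⟩
    · exact fun h => hUd _ hzU h
    · exact fun h' => U.not_adj z hzU w h' h
  obtain ⟨a, ha, hfa⟩ := hC.exists_adj_right (Or.inr ⟨hs₁, hs₁T⟩) hfs₁
  obtain ⟨b, hb, hgb⟩ := hC.exists_adj_right (Or.inr ⟨hs₂, hs₂T⟩) hgs₂
  have haU : a ∈ U.right := (hUr a).2 (Or.inl ha)
  have hbU : b ∈ U.right := (hUr b).2 (Or.inr hb)
  have hfN : ∀ x, H.Adj f x → x = v ∨ x = a := fun x hx =>
    hC.eq_or_eq_of_adj hfC hfE hfv hfa (fun h => hvU (h ▸ haU)) hx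
  have hgN : ∀ x, H.Adj g x → x = w ∨ x = b := fun x hx =>
    hC.eq_or_eq_of_adj hgC hgE hgw hgb (fun h => hwU (h ▸ hbU)) hx
  have heN : ∀ x, H.Adj e x → x = v ∨ x = u := fun x hx =>
    hC.eq_or_eq_of_adj heC heE hev heu (fun h => hd v hv (h ▸ hu)) hx
  have hzN : z ≠ w → ∀ x ∈ s.left, H.Adj z x → x = w := by
    intro h x hx hzx
    obtain ⟨h1, h2, h3⟩ := hzw.resolve_left h
    obtain ⟨y, hy, hzy⟩ := hC.exists_adj_right hst hz
    rcases hC.eq_or_eq_of_adj hzC h1 h3 hzy (fun h => hd w h2 (h ▸ hy)) hzx with h4 | h4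
    · exact h4
    · exact absurd (h4 ▸ hy) (hd x hx)
  have hfg : f ≠ g := by
    rintro rfl
    rcases hfN w hgw with h | h
    · exact hvw h.symm
    · exact hwU (h ▸ haU)
  -- Since `f` is not in `U.left` and its neighbour `v` is not in `U.right`, one of them is in the
  -- separator; likewise for `g` and `w`. By `hc` these are its only elements in `s.left`.
  obtain ⟨a', ha', haf⟩ : ∃ a' ∈ U.sep ∩ s.left, a' = v ∨ a' = f := by
    by_cases h : f ∈ U.right
    · have := fun h' => U.not_adj v h' f h hfv.symm
      exact ⟨v, mem_inter.2 ⟨mem_sep.2 ⟨this, hvU⟩, hv⟩, Or.inl rfl⟩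
    · exact ⟨f, mem_inter.2 ⟨mem_sep.2 ⟨hfU, h⟩, hf⟩, Or.inr rfl⟩
  obtain ⟨b', hb', hbg⟩ : ∃ b' ∈ U.sep ∩ s.left, b' = w ∨ b' = g := by
    by_cases h : g ∈ U.right
    · have h1 := fun h' => U.not_adj w h' g h hgw.symm
      have h2 : w ∈ s.left := by
        rcases hzw with rfl | ⟨-, h, -⟩
        · exact absurd hzU h1
        · exact h
      exact ⟨w, mem_inter.2 ⟨mem_sep.2 ⟨h1, hwU⟩, h2⟩, Or.inl rfl⟩
    · exact ⟨g, mem_inter.2 ⟨mem_sep.2 ⟨hgU, h⟩, hg⟩, Or.inr rfl⟩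
  have hab : a' ≠ b' := by grind
  have hUs : ∀ x ∈ s.left, x ∉ U.left → x ∉ U.right → x = a' ∨ x = b' := by
    intro x hx h1 h2
    have h3 : {a', b'} = U.sep ∩ s.left := by
      apply eq_of_subset_of_card_le
      · simp only [insert_subset_iff, singleton_subset_iff]
        tauto
      · rw [card_pair hab]; exact hc
    have h4 : x ∈ U.sep ∩ s.left := mem_inter.2 ⟨mem_sep.2 ⟨h1, h2⟩, hx⟩
    rw [← h3] at h4
    simpa using h4
  have hel := mem_sep.1 he
  have hzl := mem_sep.1 hz
  have hpl := mem_sep.1 hp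
  -- Cutting at `v` and `w` alone already separates `q` from `p'`: the edges `e`, `z`, `f`, `g` have
  -- no other neighbours in the part around `q`, so they can join the right side.
  let R : VertexSeparation H :=
    { left := (s.left ∩ U.left) \ {v, w}
      right := s.right ∪ U.right ∪ (({e, z, f, g} : Finset V) \ {w})
      disj := by
        intro x hx hx'
        simp only [mem_sdiff, mem_inter, mem_union, mem_insert, mem_singleton] at hx hx'
        have := hd x; have := hUd x
        grind
      not_adj := by
        intro x hx y hy hxy
        have h1 := s.not_adj x
        have h2 := U.not_adj x
        have hyx := hxy.symm
        simp only [mem_sdiff, mem_inter, mem_union, mem_insert, mem_singleton] at hx hy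
        have h3 := hd x; have h4 := hUd x
        rcases hy with (hy | hy) | ⟨rfl | rfl | rfl | rfl, hyw⟩
        · exact h1 hx.1.1 y hy hxy
        · exact h2 hx.1.2 y hy hxy
        · have := heN x hyx; grind
        · have := hzN hyw x hx.1.1 hyx; grind
        · have := hfN x hyx; grind
        · have := hgN x hyx; grind }
  have h1 := hC.three_le R
    ⟨⟨q, by simp only [R, mem_sdiff, mem_inter, mem_insert, mem_singleton]; grind, hqT⟩,
      p', by simp [R, hpU], hpT⟩
  have h2 : R.order ≤ #({v, w} : Finset V) := by
    apply order_le_card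
    intro x hx
    have h3 := hUs x
    have h4 := hS' x
    simp only [R, mem_sep, mem_sdiff, mem_inter, mem_union, mem_insert, mem_singleton] at hx ⊢
    grind
  rw [card_pair hvw] at h2
  omega

/-! ### Uncrossing the separations of consecutive edges of the cycle -/

/-- There is no critical cycle with an edge. -/
theorem notMem_edges (hC : CriticalCycle H E T T₃ C) {e : V} (heC : e ∈ C) : e ∉ E := by
  intro heE
  -- a side contains a terminal outside any other separator of an edge of the cycle
  have rich : ∀ s t : VertexSeparation H, s.order = 3 → s.Splits T₃ → ∀ e ∈ s.sep, e ∈ C → e ∈ E →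
      t.order = 3 → t.Splits T₃ → ∀ f ∈ t.sep, f ∈ C → f ∈ E →
      ∃ x ∈ s.left, x ∈ T₃ ∧ (x ∈ t.left ∨ x ∈ t.right) := by
    intro s t hs hsT e he heC heE ht htT f hf hfC hfE
    by_contra! hcon
    obtain ⟨⟨q, hq, hqT⟩, hr⟩ := hsT
    refine hC.not_unique hqT _ s rfl hs hq hr ?_ e he heC heE
    intro x hx hxT
    by_contra hxq
    obtain ⟨z, hz, hzC, hzf, -⟩ := hC.exists_mem_sep (Or.inr ⟨ht, htT⟩) hf hfC hfE
    have hxC := fun h => hC.avoids x h (hC.subset hxT)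
    have hqC := fun h => hC.avoids q h (hC.subset hqT)
    have h5 : ({x, q, f, z} : Finset V) ⊆ t.sep := by
      simp only [insert_subset_iff, singleton_subset_iff, hf, hz, and_true]
      exact ⟨mem_sep.2 (hcon x hx hxT), mem_sep.2 (hcon q hq hqT)⟩
    have h6 : #({x, q, f, z} : Finset V) = 4 := by
      rw [card_insert_of_notMem, card_insert_of_notMem, card_pair hzf.symm]
      · grind
      · grind
    have h7 := card_le_card h5
    have h8 : #t.sep = 3 := ht
    omega
  have main : ∀ n, ∀ s : VertexSeparation H, #s.left = n → s.order = 3 → s.Splits T₃ →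
      ∀ e ∈ s.sep, e ∈ C → e ∉ E := by
    intro n
    induction n using Nat.strong_induction_on with
    | _ n ih =>
    intro s hn hs hsT e he heC heE
    have hst : s.Tight T T₃ := Or.inr ⟨hs, hsT⟩
    have hd := s.disj
    obtain ⟨v, hv, hev⟩ := hC.exists_adj_left hst he
    obtain ⟨u, hu, heu⟩ := hC.exists_adj_right hst he
    have heN : ∀ x, H.Adj e x → x = v ∨ x = u := fun x hx =>
      hC.eq_or_eq_of_adj heC heE hev heu (fun h => hd v hv (h ▸ hu)) hx
    have hvC := hC.mem_of_adj heC heE hev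
    have hvE := hC.notMem_of_adj heE hev
    obtain ⟨f, hfC, hfe, hvf⟩ := hC.exists_next v hvC hvE e
    have hfE := hC.mem_of_adj' hvE hvf
    obtain ⟨t, hft, ht, htT, hvt⟩ : ∃ t : VertexSeparation H, f ∈ t.sep ∧ t.order = 3 ∧
        t.Splits T₃ ∧ v ∈ t.left := by
      obtain ⟨t, hft, ht, htT⟩ := hC.critical_three hfC hfE
      have htt : t.Tight T T₃ := Or.inr ⟨ht, htT⟩
      have hd' := t.disj
      obtain ⟨a, ha, hfa⟩ := hC.exists_adj_left htt hft
      obtain ⟨b, hb, hfb⟩ := hC.exists_adj_right htt hft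
      rcases hC.eq_or_eq_of_adj hfC hfE hfa hfb (fun h => hd' a ha (h ▸ hb)) hvf.symm with h | h
      · exact ⟨t, hft, ht, htT, h ▸ ha⟩
      · exact ⟨t.swap, by simpa using hft, by simpa using ht, htT.swap, h ▸ hb⟩
    have hd' := t.disj
    have htt : t.Tight T T₃ := Or.inr ⟨ht, htT⟩
    obtain ⟨b, hb, hfb⟩ := hC.exists_adj_right htt hft
    have hfN : ∀ x, H.Adj f x → x = v ∨ x = b := fun x hx =>
      hC.eq_or_eq_of_adj hfC hfE hvf.symm hfb (fun h => hd' v hvt (h ▸ hb)) hx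
    have hel := mem_sep.1 he
    have hfl := mem_sep.1 hft
    have hfr : f ∉ s.right := fun h => s.not_adj v hv f h hvf
    have her : e ∉ t.right := fun h => t.not_adj v hvt e h hev.symm
    -- Here `s.inf t` has order at most 3, and its separator contains both `e` and `f`. Exchanging
    -- them for their common end `v` gives `R`, of order at most 2.
    have d1 : ∀ x ∈ s.left, x ∈ t.left → x ∈ T₃ → ∀ y ∈ s.right, y ∈ t.right → y ∉ T₃ := by
      intro x hx hxt hxT y hy hyt hyT
      have o1 := hC.three_le (s.sup t) ⟨⟨x, by simp [hx], hxT⟩, y, by simp [hy, hyt], hyT⟩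
      have o2 := order_inf_add_order_sup s t
      have hxv : x ≠ v := fun h => hC.avoids v hvC (hC.subset (h ▸ hxT))
      let R : VertexSeparation H :=
        { left := (s.inf t).left.erase v
          right := (s.inf t).right ∪ {e, f}
          disj := by
            have := (s.inf t).disj
            simp only [inf_left, inf_right, mem_erase, mem_inter, mem_union, mem_insert,
              mem_singleton] at this ⊢
            grind
          not_adj := by
            intro x hx y hy hxy
            have h1 := (s.inf t).not_adj x (mem_of_mem_erase hx) y
            have h2 := heN x
            have h3 := hfN x
            have := hxy.symm
            simp only [inf_left, mem_erase, mem_inter] at hx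
            rw [mem_union, mem_insert, mem_singleton] at hy
            rcases hy with hy | rfl | rfl
            · exact h1 hy hxy
            · grind
            · grind }
      have o3 := hC.three_le R
        ⟨⟨x, by simp [R, hx, hxt, hxv], hxT⟩, y, by simp [R, hy], hyT⟩
      have o4 : R.order ≤ #(insert v (((s.inf t).sep.erase e).erase f)) := by
        apply order_le_card
        intro z hz
        simp only [R, mem_sep, inf_left, inf_right, mem_erase, mem_inter, mem_union, mem_insert,
          mem_singleton] at hz ⊢
        grind
      have o5 := card_insert_le v (((s.inf t).sep.erase e).erase f)
      have e1 : e ∈ (s.inf t).sep := by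
        simp only [mem_sep, inf_left, inf_right, mem_inter, mem_union]; tauto
      have e2 : f ∈ (s.inf t).sep := by
        simp only [mem_sep, inf_left, inf_right, mem_inter, mem_union]; tauto
      rw [card_erase_of_mem (mem_erase.2 ⟨hfe, e2⟩), card_erase_of_mem e1] at o5
      have o6 : #(s.inf t).sep = (s.inf t).order := rfl
      omega
    -- Here both corners have order exactly 3. The one inside `s.left` has `f` in its separator and
    -- is smaller, since it omits `v`.
    have d2 : ∀ x ∈ s.left, x ∈ t.right → x ∈ T₃ → ∀ y ∈ s.right, y ∈ t.left → y ∉ T₃ := by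
      intro x hx hxt hxT y hy hyt hyT
      have o1 := hC.three_le (s.sup t.swap)
        ⟨⟨x, by simp [hx], hxT⟩, y, by simp [hy, hyt], hyT⟩
      have o2 := hC.three_le (s.inf t.swap)
        ⟨⟨x, by simp [hx, hxt], hxT⟩, y, by simp [hy], hyT⟩
      have o3 := order_inf_add_order_sup s t.swap
      rw [swap_order] at o3
      refine ih _ ?_ (s.inf t.swap) rfl (by omega)
        ⟨⟨x, by simp [hx, hxt], hxT⟩, y, by simp [hy], hyT⟩ f ?_ hfC hfE
      · rw [← hn]
        apply card_lt_card
        rw [inf_left, ssubset_iff_of_subset inter_subset_left]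
        exact ⟨v, hv, fun h => hd' v hvt (mem_inter.1 h).2⟩
      · simp only [mem_sep, inf_left, inf_right, swap_left, swap_right, mem_inter, mem_union]
        tauto
    obtain ⟨x₁, h1, h1T, h1t⟩ := rich s t hs hsT e he heC heE ht htT f hft hfC hfE
    obtain ⟨x₂, h2, h2T, h2t⟩ := rich s.swap t (by simpa using hs) hsT.swap e (by simpa using he)
      heC heE ht htT f hft hfC hfE
    obtain ⟨x₃, h3, h3T, h3t⟩ := rich t s ht htT f hft hfC hfE hs hsT e he heC heE
    obtain ⟨x₄, h4, h4T, h4t⟩ := rich t.swap s (by simpa using ht) htT.swap f (by simpa using hft)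
      hfC hfE hs hsT e he heC heE
    clear rich ih
    simp only [swap_left] at h2 h4
    -- Each of the four sides has a terminal in one of its corners, so two opposite corners are
    -- occupied, against `d1` or `d2`.
    rcases h1t with h1t | h1t <;> rcases h2t with h2t | h2t <;> rcases h3t with h3t | h3t <;>
      rcases h4t with h4t | h4t <;> grind
  obtain ⟨s, he, hs, hsT⟩ := hC.critical_three heC heE
  exact main _ s rfl hs hsT e he heC heE

end CriticalCycle

/-! ### Menger's theorem for digraphs, by induction on the number of arcs -/

namespace Menger

open Finset Relation

variable {V : Type*}

/-- In the digraph `r` there is a walk from `a` to `b` inside the vertex set `W`. -/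
def ReachIn (r : V → V → Prop) (W : Set V) (a b : V) : Prop :=
  a ∈ W ∧ ReflTransGen (fun u v => r u v ∧ v ∈ W) a b

lemma ReachIn.mem_right {r : V → V → Prop} {W : Set V} {a b : V} (h : ReachIn r W a b) :
    b ∈ W := by
  rcases h.2.cases_tail with h' | ⟨c, -, -, h'⟩
  · exact h' ▸ h.1
  · exact h'

lemma ReachIn.mono {r r' : V → V → Prop} {W W' : Set V} {a b : V} (h : ReachIn r W a b)
    (hr : ∀ u v, r u v → r' u v) (hW : W ⊆ W') : ReachIn r' W' a b :=
  ⟨hW h.1, ReflTransGen.mono (fun _ _ h' => ⟨hr _ _ h'.1, hW h'.2⟩) _ _ h.2⟩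

lemma ReachIn.trans {r : V → V → Prop} {W : Set V} {a b c : V} (h : ReachIn r W a b)
    (h' : ReachIn r W b c) : ReachIn r W a c :=
  ⟨h.1, h.2.trans h'.2⟩

/-- A walk to its only vertex in the separator does not go beyond it. -/
lemma ReachIn.trim_right {r : V → V → Prop} {W R : Set V} {a t : V} (h : ReachIn r W a t)
    (ha : a ∉ R) (hW : ∀ u ∈ W, u ∉ R → u ≠ t → ∀ v, r u v → v ∉ R) :
    ReachIn r (W ∩ Rᶜ) a t := by
  refine ⟨⟨h.1, ha⟩, ?_⟩
  obtain ⟨haW, h⟩ := h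
  induction h using ReflTransGen.head_induction_on with
  | refl => exact .refl
  | @head a c hac _ ih =>
    by_cases hat : a = t
    · rw [hat]
    · have hc := hW a haW ha hat c hac.1
      exact .head ⟨hac.1, hac.2, hc⟩ (ih hc hac.2)

/-- A walk from its only vertex in the separator does not go back beyond it. -/
lemma ReachIn.trim_left {r : V → V → Prop} {W L : Set V} {b t : V} (h : ReachIn r W t b)
    (ht : t ∉ L) (hb : b ∉ L) (hW : ∀ v ∈ W, v ∉ L → v ≠ t → ∀ u, r u v → u ∉ L) :
    ReachIn r (W ∩ Lᶜ) t b := by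
  refine ⟨⟨h.1, ht⟩, ?_⟩
  obtain ⟨-, h⟩ := h
  induction h with
  | refl => exact .refl
  | @tail c b _ hcb ih =>
    by_cases hbt : b = t
    · rw [hbt]
    · have hc := hW b hcb.2 hb hbt c hcb.1
      exact (ih hc).tail ⟨hcb.1, hcb.2, hb⟩

variable [DecidableEq V]

lemma image_eq_of_injective {k : ℕ} {T : Finset V} (hT : #T = k) {τ : Fin k → V}
    (hτ : Function.Injective τ) (hτT : ∀ i, τ i ∈ T) : ∀ t ∈ T, ∃ i, τ i = t := by
  have h : univ.image τ = T := by
    apply eq_of_subset_of_card_le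
    · intro t; simp only [mem_image, mem_univ, true_and]; rintro ⟨i, rfl⟩; exact hτT i
    · rw [card_image_of_injective _ hτ, card_univ, Fintype.card_fin, hT]
  intro t ht
  rw [← h] at ht
  simpa using ht

variable [Fintype V]

/-- `(L, R)` separates `B` from `A`: there are no arcs from `L` to `R`, while `A` avoids `R` and
`B` avoids `L`. -/
structure IsCut (r : V → V → Prop) (A B : Set V) (L R : Finset V) : Prop where
  disj : ∀ x ∈ L, x ∉ R
  not_rel : ∀ x ∈ L, ∀ y ∈ R, ¬ r x y
  left : ∀ x ∈ A, x ∉ R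
  right : ∀ x ∈ B, x ∉ L

/-- **Menger's theorem** for digraphs: if no fewer than `k` vertices separate `B` from `A`, then
there are `k` pairwise disjoint vertex sets that each contain a walk from `A` to `B`. -/
theorem exists_disjoint_reachIn (n : ℕ) : ∀ r : V → V → Prop, {p : V × V | r p.1 p.2}.ncard = n →
    ∀ (A B : Set V) (k : ℕ), (∀ L R : Finset V, IsCut r A B L R → k ≤ #(L ∪ R)ᶜ) →
    ∃ W : Fin k → Set V, (∀ i j, i ≠ j → ∀ x ∈ W i, x ∉ W j) ∧
      ∀ i, ∃ a ∈ A, ∃ b ∈ B, ReachIn r (W i) a b := by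
  classical
  induction n using Nat.strong_induction_on with
  | _ n ih =>
  intro r hn A B k hk
  by_cases hr : ∃ x y, r x y
  swap
  · push Not at hr
    -- Without arcs, this cut has separator `A ∩ B`, and single vertices serve as walks.
    have h := hk (univ.filter (· ∉ B)) (univ.filter (fun x => x ∈ B ∧ x ∉ A))
      ⟨by simp; tauto, fun x _ y _ => hr x y, by simp; tauto, by simp⟩
    obtain ⟨φ⟩ : Nonempty (Fin k ↪ {x // x ∈ (univ.filter (· ∉ B) ∪
        univ.filter (fun x => x ∈ B ∧ x ∉ A))ᶜ}) :=
      Function.Embedding.nonempty_of_card_le (by simpa only [Fintype.card_fin, Fintype.card_coe])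
    refine ⟨fun i => {(φ i).1}, ?_, fun i => ?_⟩
    · rintro i j hij x rfl hx
      exact hij (φ.injective (Subtype.ext hx))
    · have := (φ i).2
      simp only [mem_compl, mem_union, mem_filter, mem_univ, true_and, not_or, not_and,
        not_not] at this
      exact ⟨_, this.2 this.1, _, this.1, rfl, .refl⟩
  obtain ⟨x, y, hxy⟩ := hr
  let r' : V → V → Prop := fun u v => r u v ∧ ¬ (u = x ∧ v = y)
  have hr' : ∀ u v, r' u v → r u v := fun u v h => h.1
  have hlt : {p : V × V | r' p.1 p.2}.ncard < n := by
    rw [← hn]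
    apply Set.ncard_lt_ncard _ (Set.toFinite _)
    rw [Set.ssubset_iff_of_subset (fun p hp => hp.1)]
    exact ⟨(x, y), hxy, fun h => h.2 ⟨rfl, rfl⟩⟩
  by_cases hcut : ∀ L R : Finset V, IsCut r' A B L R → k ≤ #(L ∪ R)ᶜ
  · obtain ⟨W, hW, h⟩ := ih _ hlt r' rfl A B k hcut
    refine ⟨W, hW, fun i => ?_⟩
    obtain ⟨a, ha, b, hb, hab⟩ := h i
    exact ⟨a, ha, b, hb, hab.mono hr' subset_rfl⟩
  push Not at hcut
  -- A cut smaller than `k` after deleting the arc must have that arc from `L` to `R`. Adding either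
  -- `x` or `y` to its separator `S` then gives exactly `k` vertices.
  obtain ⟨L, R, hLR, hlt'⟩ := hcut
  have hd := hLR.disj
  have hxyLR : x ∈ L ∧ y ∈ R := by
    by_contra h
    apply hlt'.not_ge
    refine hk L R ⟨hd, fun u hu v hv huv => ?_, hLR.left, hLR.right⟩
    refine hLR.not_rel u hu v hv ⟨huv, ?_⟩
    rintro ⟨rfl, rfl⟩
    exact h ⟨hu, hv⟩
  obtain ⟨hxL, hyR⟩ := hxyLR
  obtain ⟨S, hS⟩ : ∃ S, S = (L ∪ R)ᶜ := ⟨_, rfl⟩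
  rw [← hS] at hlt'
  have hmS : ∀ z, z ∈ S ↔ z ∉ L ∧ z ∉ R := by simp [hS]
  have hxS : x ∉ S := fun h => ((hmS x).1 h).1 hxL
  have hyS : y ∉ S := fun h => ((hmS y).1 h).2 hyR
  have hT : #(insert x S) = k := by
    have h := hk (L.erase x) R ⟨fun z hz => hd z (mem_of_mem_erase hz), fun u hu v hv huv =>
      hLR.not_rel u (mem_of_mem_erase hu) v hv ⟨huv, fun h => (mem_erase.1 hu).1 h.1⟩, hLR.left,
      fun z hz hz' => hLR.right z hz (mem_of_mem_erase hz')⟩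
    have h2 : #(L.erase x ∪ R)ᶜ ≤ #(insert x S) := by
      apply card_le_card
      intro z
      simp only [mem_compl, mem_union, mem_erase, mem_insert, hmS]
      tauto
    have h3 := card_insert_le x S
    omega
  have hT' : #(insert y S) = k := by
    rw [card_insert_of_notMem hyS]
    rw [card_insert_of_notMem hxS] at hT
    exact hT
  -- A cut between `A` and `S ∪ {x}` in the smaller digraph, combined with `L` and `R`, cuts `A`
  -- from `B` in the full digraph. Its separator is no larger, so the induction hypothesis applies;
  -- the second half is symmetric.
  obtain ⟨W, hW, hWr⟩ := ih _ hlt r' rfl A (insert x S : Finset V) k (by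
    intro L' R' h
    refine (hk (L ∩ L') (R ∪ R') ⟨?_, ?_, ?_, ?_⟩).trans (card_le_card ?_)
    · have := h.disj
      simp only [mem_inter, mem_union]
      grind
    · intro u hu v hv huv
      have hux : u ≠ x := by
        rintro rfl
        exact h.right u (by simp) (mem_inter.1 hu).2
      have huv' : r' u v := ⟨huv, fun h => hux h.1⟩
      rcases mem_union.1 hv with hv | hv
      · exact hLR.not_rel u (mem_inter.1 hu).1 v hv huv'
      · exact h.not_rel u (mem_inter.1 hu).2 v hv huv'
    · intro z hz
      simp [hLR.left z hz, h.left z hz]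
    · intro z hz hz'
      exact hLR.right z hz (mem_inter.1 hz').1
    · intro z
      have h1 := h.right z
      simp only [coe_insert, Set.mem_insert_iff, mem_coe, hmS] at h1
      simp only [mem_compl, mem_union, mem_inter]
      grind)
  obtain ⟨W', hW', hWr'⟩ := ih _ hlt r' rfl (insert y S : Finset V) B k (by
    intro L' R' h
    refine (hk (L ∪ L') (R ∩ R') ⟨?_, ?_, ?_, ?_⟩).trans (card_le_card ?_)
    · have := h.disj
      simp only [mem_inter, mem_union]
      grind
    · intro u hu v hv huv
      have hvy : v ≠ y := by
        rintro rfl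
        exact h.left v (by simp) (mem_inter.1 hv).2
      have huv' : r' u v := ⟨huv, fun h => hvy h.2⟩
      rcases mem_union.1 hu with hu | hu
      · exact hLR.not_rel u hu v (mem_inter.1 hv).1 huv'
      · exact h.not_rel u hu v (mem_inter.1 hv).2 huv'
    · intro z hz hz'
      exact hLR.left z hz (mem_inter.1 hz').1
    · intro z hz
      simp [hLR.right z hz, h.right z hz]
    · intro z
      have h1 := h.left z
      simp only [coe_insert, Set.mem_insert_iff, mem_coe, hmS] at h1
      simp only [mem_compl, mem_union, mem_inter]
      grind)
  choose a ha τ hτ hτr using hWr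
  choose τ' hτ' b hb hτr' using hWr'
  have hτW := fun i => (hτr i).mem_right
  have hτW' := fun i => (hτr' i).1
  have hτi : Function.Injective τ := by
    intro i j hij
    by_contra h
    exact hW i j h _ (hτW i) (hij ▸ hτW j)
  have hτi' : Function.Injective τ' := by
    intro i j hij
    by_contra h
    exact hW' i j h _ (hτW' i) (hij ▸ hτW' j)
  have hτu : ∀ i, ∀ t ∈ W i, t ∈ insert x S → t = τ i := by
    intro i t ht htT
    obtain ⟨j, rfl⟩ := image_eq_of_injective hT hτi hτ t htT
    by_contra h
    exact hW i j (fun h' => h (h' ▸ rfl)) _ ht (hτW j)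
  have hτs := image_eq_of_injective hT' hτi' hτ'
  have hτu' : ∀ i, ∀ t ∈ W' i, t ∈ insert y S → t = τ' i := by
    intro i t ht htT
    obtain ⟨j, rfl⟩ := hτs t htT
    by_contra h
    exact hW' i j (fun h' => h (h' ▸ rfl)) _ ht (hτW' j)
  -- Each walk ending in `S` is continued by the walk starting there; the one ending in `x` is
  -- continued through the arc to `y`.
  have hj : ∀ i, ∃ j, τ i = x ∧ τ' j = y ∨ τ i ∈ S ∧ τ' j = τ i := by
    intro i
    rcases mem_insert.1 (hτ i) with h | h
    · obtain ⟨j, hj⟩ := hτs y (mem_insert_self _ _)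
      exact ⟨j, Or.inl ⟨h, hj⟩⟩
    · obtain ⟨j, hj⟩ := hτs (τ i) (mem_insert_of_mem h)
      exact ⟨j, Or.inr ⟨h, hj⟩⟩
  choose j hj using hj
  have hji : ∀ i i', i ≠ i' → j i ≠ j i' := by
    intro i i' hii h
    have h1 := hj i
    have h2 := hj i'
    rw [← h] at h2
    have h3 : τ i ≠ τ i' := fun h => hii (hτi h)
    grind
  -- First halves are trimmed to avoid `R` and second halves to avoid `L`, so they can meet only in
  -- `S`, where they are matched.
  refine ⟨fun i => (W i ∩ (R : Set V)ᶜ) ∪ (W' (j i) ∩ (L : Set V)ᶜ), ?_, fun i => ?_⟩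
  · have key : ∀ i i', i ≠ i' → ∀ z, z ∈ W i → z ∉ R → z ∈ W' (j i') → z ∉ L → False := by
      intro i i' hii z h1 h2 h3 h4
      have hzS : z ∈ S := (hmS z).2 ⟨h4, h2⟩
      have h5 := hτu i z h1 (mem_insert_of_mem hzS)
      have h6 := hτu' (j i') z h3 (mem_insert_of_mem hzS)
      have h7 : τ i ≠ τ i' := fun h => hii (hτi h)
      have h8 := hj i'
      grind
    intro i i' hii z hz hz'
    rcases hz with ⟨h1, h2⟩ | ⟨h1, h2⟩ <;> rcases hz' with ⟨h3, h4⟩ | ⟨h3, h4⟩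
    · exact hW i i' hii z h1 h3
    · exact key i i' hii z h1 h2 h3 h4
    · exact key i' i hii.symm z h3 h4 h1 h2
    · exact hW' _ _ (hji i i' hii) z h1 h3
  · refine ⟨a i, ha i, b (j i), hb (j i), ?_⟩
    have h1 : ReachIn r' (W i ∩ (R : Set V)ᶜ) (a i) (τ i) := by
      refine (hτr i).trim_right (hLR.left _ (ha i)) ?_
      intro u hu huR hut v huv hvR
      have h2 : u ∉ S := fun h => hut (hτu i u hu (mem_insert_of_mem h))
      have h3 : u ∈ L := by
        by_contra h; exact h2 ((hmS u).2 ⟨h, huR⟩)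
      exact hLR.not_rel u h3 v hvR huv
    have h2 : ReachIn r' (W' (j i) ∩ (L : Set V)ᶜ) (τ' (j i)) (b (j i)) := by
      refine (hτr' (j i)).trim_left ?_ (hLR.right _ (hb (j i))) ?_
      · intro h
        rcases mem_insert.1 (hτ' (j i)) with h' | h'
        · exact hd _ h (h' ▸ hyR)
        · exact ((hmS _).1 h').1 h
      · intro v hv hvL hvt u huv huL
        have h2 : v ∉ S := fun h => hvt (hτu' (j i) v hv (mem_insert_of_mem h))
        have h3 : v ∈ R := by
          by_contra h; exact h2 ((hmS v).2 ⟨hvL, h⟩)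
        exact hLR.not_rel u huL v h3 huv
    have h1' := h1.mono (W' := (W i ∩ (R : Set V)ᶜ) ∪ (W' (j i) ∩ (L : Set V)ᶜ)) hr'
      Set.subset_union_left
    have h2' := h2.mono (W' := (W i ∩ (R : Set V)ᶜ) ∪ (W' (j i) ∩ (L : Set V)ᶜ)) hr'
      Set.subset_union_right
    refine h1'.trans (ReachIn.trans (b := τ' (j i)) ⟨h1'.mem_right, ?_⟩ h2')
    rcases hj i with ⟨h3, h4⟩ | ⟨-, h4⟩
    · rw [h3, h4]
      exact .single ⟨hxy, h4 ▸ h2'.1⟩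
    · rw [h4]

end Menger

/-! ### From paths in the multigraph to separations of its incidence graph -/

namespace Graph

open Finset

variable {α β : Type*}

/-- The vertices and edges of `G`. -/
def elements (G : Graph α β) : Set (α ⊕ β) := Sum.inl '' G.vertexSet ∪ Sum.inr '' G.edgeSet

@[simp] lemma inl_mem_elements {G : Graph α β} {v : α} :
    Sum.inl v ∈ G.elements ↔ v ∈ G.vertexSet := by simp [elements]

@[simp] lemma inr_mem_elements {G : Graph α β} {e : β} :
    Sum.inr e ∈ G.elements ↔ e ∈ G.edgeSet := by simp [elements]

/-- Incidence between vertices and edges. -/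
def IncAdj (G : Graph α β) : α ⊕ β → α ⊕ β → Prop
  | Sum.inl v, Sum.inr e => G.Inc e v
  | Sum.inr e, Sum.inl v => G.Inc e v
  | _, _ => False

lemma IncAdj.symm {G : Graph α β} : ∀ {x y : α ⊕ β}, G.IncAdj x y → G.IncAdj y x
  | Sum.inl _, Sum.inr _, h => h
  | Sum.inr _, Sum.inl _, h => h

/-- The bipartite incidence graph on the vertices and edges of `G`. -/
def incidenceGraph (G : Graph α β) : SimpleGraph G.elements where
  Adj x y := G.IncAdj x y
  symm := ⟨fun _ _ h => h.symm⟩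
  loopless := ⟨by rintro ⟨x | x, hx⟩ h <;> exact h⟩

lemma incidenceGraph_adj {G : Graph α β} {x y : G.elements} :
    G.incidenceGraph.Adj x y ↔ G.IncAdj x y := Iff.rfl

lemma Inc.isLink_of_ne {G : Graph α β} {e : β} {u v : α} (hu : G.Inc e u) (hv : G.Inc e v)
    (huv : u ≠ v) : G.IsLink e u v := by
  obtain ⟨u', h⟩ := hu
  rcases hv.eq_or_eq_of_isLink h with rfl | rfl
  · exact absurd rfl huv
  · exact h

/-- Each walk contains a path. -/
lemma IsWalkFrom.exists_isPathFrom {G : Graph α β} {y : α} : ∀ {w : List (β × α)} {x : α},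
    G.IsWalkFrom x w y → ∃ w', G.IsPathFrom x w' y ∧
      (∀ v ∈ walkVertices x w', v ∈ walkVertices x w) ∧ ∀ e ∈ walkEdges w', e ∈ walkEdges w := by
  have suffix : ∀ (w : List (β × α)) (v x : α), G.IsPathFrom v w y → x ∈ walkVertices v w →
      ∃ w', G.IsPathFrom x w' y ∧ (∀ u ∈ walkVertices x w', u ∈ walkVertices v w) ∧
        ∀ e ∈ walkEdges w', e ∈ walkEdges w := by
    intro w
    induction w with
    | nil =>
      intro v x h hx
      obtain rfl : x = v := by simpa [walkVertices] using hx
      exact ⟨[], h, fun _ h => h, fun _ h => h⟩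
    | cons p w ih =>
      obtain ⟨e, u⟩ := p
      intro v x h hx
      by_cases hxv : x = v
      · subst hxv
        exact ⟨_, h, fun _ h => h, fun _ h => h⟩
      · obtain ⟨h1, h2⟩ := h
        have hx' : x ∈ walkVertices u w := by
          simpa [walkVertices, hxv] using hx
        have h2' : (walkVertices u w).Nodup := by
          simp only [walkVertices, List.map_cons] at h2 ⊢
          exact h2.of_cons
        obtain ⟨w', h3, h4, h5⟩ := ih u x ⟨h1.2, h2'⟩ hx'
        exact ⟨w', h3, fun z hz => List.mem_cons_of_mem _ (h4 z hz),
          fun z hz => List.mem_cons_of_mem _ (h5 z hz)⟩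
  intro w
  induction w with
  | nil => exact fun h => ⟨[], ⟨h, by simp [walkVertices]⟩, fun _ h => h, fun _ h => h⟩
  | cons p w ih =>
    obtain ⟨e, u⟩ := p
    intro x h
    obtain ⟨w', h1, h2, h3⟩ := ih h.2
    by_cases hx : x ∈ walkVertices u w'
    · obtain ⟨w'', h4, h5, h6⟩ := suffix w' u x h1 hx
      exact ⟨w'', h4, fun z hz => List.mem_cons_of_mem _ (h2 z (h5 z hz)),
        fun z hz => List.mem_cons_of_mem _ (h3 z (h6 z hz))⟩
    · refine ⟨(e, u) :: w', ⟨⟨h.1, h1.1⟩, List.nodup_cons.2 ⟨hx, h1.2⟩⟩, ?_, ?_⟩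
      · intro z hz
        rcases List.mem_cons.1 hz with rfl | hz
        · exact List.mem_cons_self
        · exact List.mem_cons_of_mem _ (h2 z hz)
      · intro z hz
        rcases List.mem_cons.1 hz with rfl | hz
        · exact List.mem_cons_self
        · exact List.mem_cons_of_mem _ (h3 z hz)

section Finite

variable {G : Graph α β} [Fintype G.elements] [DecidableEq G.elements]

/-- A walk between the sides of a separation meets the separator. -/
lemma IsWalkFrom.exists_mem_sep (s : VertexSeparation G.incidenceGraph) {y : α}
    (hy : ∃ z ∈ s.right, z.1 = Sum.inl y) : ∀ {w : List (β × α)} {x : α}, G.IsWalkFrom x w y →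
      (∃ z ∈ s.left, z.1 = Sum.inl x) → ∃ z ∈ s.sep,
        (∃ v ∈ walkVertices x w, z.1 = Sum.inl v) ∨ ∃ e ∈ walkEdges w, z.1 = Sum.inr e := by
  intro w
  induction w with
  | nil =>
    rintro x ⟨rfl, -⟩ ⟨z, hz, hzx⟩
    obtain ⟨z', hz', hzx'⟩ := hy
    exact absurd (Subtype.ext (hzx.trans hzx'.symm) ▸ hz') (s.disj z hz)
  | cons p w ih =>
    obtain ⟨e, u⟩ := p
    rintro x ⟨h1, h2⟩ ⟨z, hz, hzx⟩
    let e' : G.elements := ⟨Sum.inr e, by simpa using h1.edge_mem⟩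
    let u' : G.elements := ⟨Sum.inl u, by simpa using h1.right_mem⟩
    by_cases he : e' ∈ s.sep
    · exact ⟨e', he, Or.inr ⟨e, List.mem_cons_self, rfl⟩⟩
    have he' : e' ∈ s.left := by
      by_contra h
      refine he (VertexSeparation.mem_sep.2 ⟨h, fun h' => s.not_adj z hz _ h' ?_⟩)
      rw [incidenceGraph_adj, hzx]
      exact h1.inc_left
    by_cases hu : u' ∈ s.sep
    · exact ⟨u', hu, Or.inl ⟨u, by simp [walkVertices], rfl⟩⟩
    have hu' : u' ∈ s.left := by
      by_contra h
      exact hu (VertexSeparation.mem_sep.2 ⟨h, fun h' => s.not_adj _ he' _ h' h1.inc_right⟩)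
    obtain ⟨z', hz', h⟩ := ih h2 ⟨u', hu', rfl⟩
    refine ⟨z', hz', h.imp ?_ ?_⟩
    · rintro ⟨v, hv, h⟩
      exact ⟨v, List.mem_cons_of_mem _ hv, h⟩
    · rintro ⟨v, hv, h⟩
      exact ⟨v, List.mem_cons_of_mem _ hv, h⟩

/-- The easy direction of Menger's theorem. -/
lemma VertexConnected.le_order {k : ℕ} {x y : α} (h : G.VertexConnected k x y)
    (s : VertexSeparation G.incidenceGraph) (hx : ∃ z ∈ s.left, z.1 = Sum.inl x)
    (hy : ∃ z ∈ s.right, z.1 = Sum.inl y) : k ≤ s.order := by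
  obtain ⟨P, hP, hd⟩ := h
  choose f hf hf' using fun i => (hP i).1.exists_mem_sep s hy hx
  have hinj : Function.Injective f := by
    intro i j hij
    by_contra hne
    have h1 := hf' i
    have h2 := hf' j
    have h3 := VertexSeparation.mem_sep.1 (hf i)
    rw [← hij] at h2
    obtain ⟨d1, d2⟩ := hd i j hne
    rcases h1 with ⟨v, hv, hv'⟩ | ⟨e, he, he'⟩ <;> rcases h2 with ⟨u, hu, hu'⟩ | ⟨g, hg, hg'⟩
    · obtain rfl : v = u := Sum.inl_injective (hv'.symm.trans hu')
      obtain ⟨x', hx', hxx⟩ := hx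
      obtain ⟨y', hy', hyy⟩ := hy
      rcases d1 v hv hu with rfl | rfl
      · exact h3.1 (Subtype.ext (hxx.trans hv'.symm) ▸ hx')
      · exact h3.2 (Subtype.ext (hyy.trans hv'.symm) ▸ hy')
    · rw [hv'] at hg'; cases hg'
    · rw [hu'] at he'; cases he'
    · obtain rfl : e = g := Sum.inr_injective (he'.symm.trans hg')
      exact d2 he hg
  calc k = #(univ.image f) := by
        rw [card_image_of_injective _ hinj, card_univ, Fintype.card_fin]
    _ ≤ #s.sep := by
        apply card_le_card
        intro z
        simp only [mem_image, mem_univ, true_and]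
        rintro ⟨i, rfl⟩
        exact hf i

/-- The hard direction of Menger's theorem, in a graph with an edge deleted. -/
lemma exists_separation {k : ℕ} {x y : α} {e : β} (hx : x ∈ G.vertexSet) (hy : y ∈ G.vertexSet)
    (he : e ∈ G.edgeSet) (hxy : x ≠ y) (h : ¬ (G.deleteEdges {e}).VertexConnected k x y) :
    ∃ s : VertexSeparation G.incidenceGraph, (∃ z ∈ s.left, z.1 = Sum.inl x) ∧
      (∃ z ∈ s.right, z.1 = Sum.inl y) ∧ (∃ z ∈ s.sep, z.1 = Sum.inr e) ∧ s.order ≤ k := by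
  obtain ⟨x', hx'⟩ : ∃ z : G.elements, z.1 = Sum.inl x := ⟨⟨Sum.inl x, by simpa using hx⟩, rfl⟩
  obtain ⟨y', hy'⟩ : ∃ z : G.elements, z.1 = Sum.inl y := ⟨⟨Sum.inl y, by simpa using hy⟩, rfl⟩
  obtain ⟨e', he'⟩ : ∃ z : G.elements, z.1 = Sum.inr e := ⟨⟨Sum.inr e, by simpa using he⟩, rfl⟩
  have hxy' : x' ≠ y' := fun h => hxy (Sum.inl_injective (by rw [← hx', ← hy', h]))
  have hxe : x' ≠ e' := fun h => by rw [h, he'] at hx'; cases hx'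
  have hye : y' ≠ e' := fun h => by rw [h, he'] at hy'; cases hy'
  -- Menger's theorem is applied between the neighbourhoods of `x'` and `y'`, since the paths share
  -- their ends. These neighbours are edges, so parallel edges from `x` to `y` count separately and
  -- each counts once.
  let r : G.elements → G.elements → Prop := fun u v =>
    G.incidenceGraph.Adj u v ∧ v ≠ x' ∧ v ≠ y' ∧ v ≠ e' ∧ u ≠ x' ∧ u ≠ y' ∧ u ≠ e'
  let A : Set G.elements := {a | G.incidenceGraph.Adj x' a ∧ a ≠ e'}
  let B : Set G.elements := {b | G.incidenceGraph.Adj b y' ∧ b ≠ e'}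
  by_cases hk : ∀ L R : Finset G.elements, Menger.IsCut r A B L R → k ≤ #(L ∪ R)ᶜ
  · exfalso
    obtain ⟨W, hW, hWr⟩ := Menger.exists_disjoint_reachIn _ r rfl A B k hk
    apply h
    have walk : ∀ i, ∃ w, (G.deleteEdges {e}).IsPathFrom x w y ∧
        (∀ v ∈ walkVertices x w, v = x ∨ v = y ∨ ∃ z ∈ W i, z.1 = Sum.inl v) ∧
        ∀ f ∈ walkEdges w, ∃ z ∈ W i, z.1 = Sum.inr f := by
      intro i
      obtain ⟨a, ha, b, hb, haW, hab⟩ := hWr i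
      -- The induction records the current vertex `u`: the walk stands at `u`, or on an edge entered
      -- from `u`. If it leaves that edge through `u` again, no step is added.
      have key : ∀ u, (a.1 = Sum.inl u ∨ ∃ f, a.1 = Sum.inr f ∧ G.Inc f u) →
          (u = x ∨ u = y ∨ ∃ z ∈ W i, z.1 = Sum.inl u) →
          ∃ w, (G.deleteEdges {e}).IsWalkFrom u w y ∧
            (∀ v ∈ walkVertices u w, v = x ∨ v = y ∨ ∃ z ∈ W i, z.1 = Sum.inl v) ∧
            ∀ f ∈ walkEdges w, ∃ z ∈ W i, z.1 = Sum.inr f := by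
        clear ha
        induction hab using Relation.ReflTransGen.head_induction_on with
        | refl =>
          intro u hu hPu
          have hb1 := hb.1
          rw [incidenceGraph_adj, hy'] at hb1
          rcases hu with hu | ⟨f, hf, hfu⟩
          · rw [hu] at hb1; exact hb1.elim
          · rw [hf] at hb1
            change G.Inc f y at hb1
            have hfe : f ≠ e := fun h => hb.2 (Subtype.ext (by rw [hf, he', h]))
            by_cases huy : u = y
            · subst huy
              refine ⟨[], ⟨rfl, hy⟩, ?_, by simp [walkEdges]⟩
              simp [walkVertices]
            · refine ⟨[(f, y)], ⟨?_, rfl, by simpa using hy⟩, ?_, ?_⟩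
              · simpa [hfe] using hfu.isLink_of_ne hb1 huy
              · simpa [walkVertices] using hPu
              · simp only [walkEdges, List.map_cons, List.map_nil, List.mem_singleton]
                rintro g rfl
                exact ⟨b, haW, hf⟩
        | @head a c hac _ ih =>
          intro u hu hPu
          obtain ⟨⟨hadj, -, -, -, -, -, hae⟩, hcW⟩ := hac
          rw [incidenceGraph_adj] at hadj
          rcases hu with hu | ⟨f, hf, hfu⟩
          · rw [hu] at hadj
            rcases hc : c.1 with v | g
            · rw [hc] at hadj; exact hadj.elim
            · rw [hc] at hadj
              exact ih hcW u (Or.inr ⟨g, hc, hadj⟩) hPu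
          · rw [hf] at hadj
            rcases hc : c.1 with v | g
            · rw [hc] at hadj
              change G.Inc f v at hadj
              by_cases huv : u = v
              · exact ih hcW u (Or.inl (huv ▸ hc)) hPu
              · have hfe : f ≠ e := fun h => hae (Subtype.ext (by rw [hf, he', h]))
                obtain ⟨w, h1, h2, h3⟩ := ih hcW v (Or.inl hc) (Or.inr (Or.inr ⟨c, hcW, hc⟩))
                refine ⟨(f, v) :: w, ⟨?_, h1⟩, ?_, ?_⟩
                · simpa [hfe] using hfu.isLink_of_ne hadj huv
                · intro z hz
                  rcases List.mem_cons.1 hz with rfl | hz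
                  · exact hPu
                  · exact h2 z hz
                · intro z hz
                  rcases List.mem_cons.1 hz with rfl | hz
                  · exact ⟨a, haW, hf⟩
                  · exact h3 z hz
            · rw [hc] at hadj; exact hadj.elim
      have ha1 := ha.1
      rw [incidenceGraph_adj, hx'] at ha1
      obtain ⟨w, h1, h2, h3⟩ := key x (by
        rcases hc : a.1 with v | g
        · rw [hc] at ha1; exact ha1.elim
        · rw [hc] at ha1
          exact Or.inr ⟨g, rfl, ha1⟩) (Or.inl rfl)
      obtain ⟨w', h4, h5, h6⟩ := h1.exists_isPathFrom
      exact ⟨w', h4, fun v hv => h2 v (h5 v hv), fun f hf => h3 f (h6 f hf)⟩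
    choose P hP hPv hPe using walk
    refine ⟨P, hP, fun i j hij => ⟨fun v hi hj => ?_, fun f hi hj => ?_⟩⟩
    · rcases hPv i v hi with h | h | ⟨z, hz, hzv⟩
      · exact Or.inl h
      · exact Or.inr h
      rcases hPv j v hj with h | h | ⟨z', hz', hzv'⟩
      · exact Or.inl h
      · exact Or.inr h
      exact (hW i j hij z hz (Subtype.ext (hzv.trans hzv'.symm) ▸ hz')).elim
    · obtain ⟨z, hz, hzv⟩ := hPe i f hi
      obtain ⟨z', hz', hzv'⟩ := hPe j f hj
      exact hW i j hij z hz (Subtype.ext (hzv.trans hzv'.symm) ▸ hz')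
  · push Not at hk
    obtain ⟨L, R, hLR, hlt⟩ := hk
    have hnxy : ¬ G.incidenceGraph.Adj x' y' := by
      rw [incidenceGraph_adj, hx', hy']; exact id
    -- The ends are put on their sides and `e'` into the separator, which raises the order from less
    -- than `k` to at most `k`.
    refine ⟨{ left := insert x' (L \ {y', e'})
              right := insert y' (R \ {x', e'})
              disj := ?_
              not_adj := ?_ }, ⟨x', by simp, hx'⟩, ⟨y', by simp, hy'⟩, ⟨e', ?_, he'⟩, ?_⟩
    · have := hLR.disj
      simp only [mem_insert, mem_sdiff, mem_singleton]
      grind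
    · intro u hu v hv huv
      have h1 := hLR.left v
      have h2 := hLR.right u
      have h3 := hLR.not_rel u
      simp only [mem_insert, mem_sdiff, mem_singleton, not_or] at hu hv
      by_cases hux : u = x'
      · subst hux
        rcases hv with rfl | ⟨hv, hv'⟩
        · exact hnxy huv
        · exact h1 ⟨huv, hv'.2⟩ hv
      obtain ⟨huL, huy, hue⟩ := hu.resolve_left hux
      by_cases hvy : v = y'
      · subst hvy
        exact h2 ⟨huv, hue⟩ huL
      obtain ⟨hvR, hvx, hve⟩ := hv.resolve_left hvy
      exact h3 huL v hvR ⟨huv, hvx, hvy, hve, hux, huy, hue⟩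
    · simp [hxe.symm, hye.symm]
    · refine (VertexSeparation.order_le_card (X := insert e' (L ∪ R)ᶜ) ?_).trans ?_
      · intro z
        simp only [VertexSeparation.mem_sep, mem_insert, mem_sdiff, mem_singleton, mem_compl,
          mem_union]
        tauto
      · exact (card_insert_le _ _).trans hlt

end Finite

/-! ### The cyclic list of the vertices and edges of a cycle -/

/-- The edges and vertices of a walk after its first vertex, in order. -/
def walkElements (w : List (β × α)) : List (α ⊕ β) :=
  w.flatMap fun p => [Sum.inr p.1, Sum.inl p.2]

lemma inl_mem_walkElements {w : List (β × α)} {v : α} :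
    Sum.inl v ∈ walkElements w ↔ v ∈ w.map Prod.snd := by
  simp [walkElements]

lemma inr_mem_walkElements {w : List (β × α)} {e : β} :
    Sum.inr e ∈ walkElements w ↔ e ∈ walkEdges w := by
  simp [walkElements, walkEdges]

lemma length_walkElements (w : List (β × α)) : (walkElements w).length = 2 * w.length := by
  induction w with
  | nil => rfl
  | cons p w ih => simp only [walkElements, List.flatMap_cons, List.length_append,
      List.length_cons, List.length_nil] at ih ⊢; omega

lemma nodup_walkElements {w : List (β × α)} (h : (walkEdges w).Nodup)
    (h' : (w.map Prod.snd).Nodup) : (walkElements w).Nodup := by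
  induction w with
  | nil => simp [walkElements]
  | cons p w ih =>
    obtain ⟨e, v⟩ := p
    have h1 : e ∉ walkEdges w := (List.nodup_cons.1 h).1
    have h2 : v ∉ w.map Prod.snd := (List.nodup_cons.1 h').1
    have h3 := ih (List.nodup_cons.1 h).2 (List.nodup_cons.1 h').2
    change (Sum.inr e :: Sum.inl v :: walkElements w).Nodup
    rw [List.nodup_cons, List.nodup_cons, List.mem_cons, inl_mem_walkElements, inr_mem_walkElements]
    simp [h1, h2, h3]

lemma IsWalkFrom.isChain {G : Graph α β} {y : α} : ∀ {w : List (β × α)} {x : α},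
    G.IsWalkFrom x w y → (Sum.inl x :: walkElements w).IsChain G.IncAdj := by
  intro w
  induction w with
  | nil => intro x _; simp [walkElements]
  | cons p w ih =>
    obtain ⟨e, v⟩ := p
    intro x h
    change (Sum.inl x :: Sum.inr e :: Sum.inl v :: walkElements w).IsChain G.IncAdj
    rw [List.isChain_cons_cons, List.isChain_cons_cons]
    exact ⟨h.1.inc_left, h.1.inc_right, ih h.2⟩

lemma IsWalkFrom.exists_eq_append {G : Graph α β} {y : α} : ∀ {w : List (β × α)} {x : α},
    G.IsWalkFrom x w y → w ≠ [] → ∃ l, walkElements w = l ++ [Sum.inl y] := by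
  intro w
  induction w with
  | nil => intro x _ h; exact absurd rfl h
  | cons p w ih =>
    obtain ⟨e, v⟩ := p
    intro x h _
    by_cases hw : w = []
    · subst hw
      obtain ⟨rfl, -⟩ := h.2
      exact ⟨[Sum.inr e], rfl⟩
    · obtain ⟨l, hl⟩ := ih h.2 hw
      refine ⟨Sum.inr e :: Sum.inl v :: l, ?_⟩
      change Sum.inr e :: Sum.inl v :: walkElements w = _
      rw [hl]
      rfl

/-- A cycle can be traversed starting from any of its elements. -/
lemma IsCycleFrom.exists_rotation {G : Graph α β} {x : α} {w : List (β × α)}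
    (h : G.IsCycleFrom x w) {z : α ⊕ β} (hz : z ∈ walkElements w) :
    ∃ m : List (α ⊕ β), (z :: m).Perm (walkElements w) ∧
      (z :: (m ++ [z])).IsChain G.IncAdj := by
  obtain ⟨hw, hne, -, -⟩ := h
  have hc := hw.isChain
  obtain ⟨l, hl⟩ := hw.exists_eq_append hne
  obtain ⟨l₁, l₂, h₁₂⟩ := List.append_of_mem hz
  rw [h₁₂] at hc
  have c1 : (Sum.inl x :: (l₁ ++ [z])).IsChain G.IncAdj := by
    apply hc.prefix
    simp
  have c2 : (z :: l₂).IsChain G.IncAdj := hc.suffix ⟨Sum.inl x :: l₁, by simp⟩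
  rcases List.eq_nil_or_concat l₂ with rfl | ⟨l₃, a, rfl⟩
  · rw [hl] at h₁₂
    obtain ⟨-, h4⟩ := List.append_inj' h₁₂ rfl
    obtain rfl : Sum.inl x = z := by simpa using h4
    refine ⟨l₁, ?_, c1⟩
    rw [hl, h₁₂]
    exact (List.perm_append_singleton _ _).symm
  · rw [hl] at h₁₂
    have h5 : l₁ ++ z :: (l₃ ++ [a]) = (l₁ ++ z :: l₃) ++ [a] := by simp
    rw [List.concat_eq_append, h5] at h₁₂
    obtain ⟨-, h4⟩ := List.append_inj' h₁₂ rfl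
    obtain rfl : Sum.inl x = a := by simpa using h4
    refine ⟨l₃ ++ [Sum.inl x] ++ l₁, ?_, ?_⟩
    · rw [hl, h₁₂]
      have : z :: (l₃ ++ [Sum.inl x] ++ l₁) = (z :: l₃ ++ [Sum.inl x]) ++ l₁ := by simp
      rw [this]
      refine List.perm_append_comm.trans ?_
      simp
    · have := List.IsChain.append_overlap (l₁ := z :: l₃) (l₂ := [Sum.inl x]) (l₃ := l₁ ++ [z])
        (by simpa using c2) (by simpa using c1) (by simp)
      simpa using this

/-- A chain that meets a set and its complement crosses between them. -/
lemma _root_.List.IsChain.exists_crossing {γ : Type*} {R : γ → γ → Prop}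
    (hR : ∀ x y, R x y → R y x) {P : γ → Prop} : ∀ {l : List γ}, l.IsChain R →
    (∃ x ∈ l, P x) → (∃ x ∈ l, ¬ P x) → ∃ x ∈ l, ∃ y ∈ l, P x ∧ ¬ P y ∧ R x y := by
  intro l
  induction l with
  | nil => simp
  | cons a l ih =>
    intro hl h1 h2
    cases l with
    | nil => grind
    | cons b l =>
      rw [List.isChain_cons_cons] at hl
      have := hR a b
      by_cases h3 : ∃ x ∈ b :: l, P x
      · by_cases h4 : ∃ x ∈ b :: l, ¬ P x
        · obtain ⟨x, hx, y, hy, h⟩ := ih hl.2 h3 h4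
          exact ⟨x, List.mem_cons_of_mem _ hx, y, List.mem_cons_of_mem _ hy, h⟩
        · push Not at h4
          have := h4 b (by simp)
          exact ⟨b, by simp, a, by simp, this, by grind, hR _ _ hl.1⟩
      · push Not at h3
        have := h3 b (by simp)
        exact ⟨a, by simp, b, by simp, by grind, this, hl.1⟩

variable {G : Graph α β}

lemma IsWalkFrom.mem_elements {y : α} : ∀ {w : List (β × α)} {x : α}, G.IsWalkFrom x w y →
    ∀ z ∈ walkElements w, z ∈ G.elements := by
  intro w
  induction w with
  | nil => simp [walkElements]
  | cons p w ih =>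
    obtain ⟨e, v⟩ := p
    intro x h z hz
    change z ∈ Sum.inr e :: Sum.inl v :: walkElements w at hz
    rcases List.mem_cons.1 hz with rfl | hz
    · simpa using h.1.edge_mem
    rcases List.mem_cons.1 hz with rfl | hz
    · simpa using h.1.right_mem
    · exact ih h.2 z hz

lemma IsWalkFrom.exists_isLink {y : α} : ∀ {w : List (β × α)} {x : α}, G.IsWalkFrom x w y →
    ∀ e ∈ walkEdges w, ∃ u ∈ walkVertices x w, ∃ v ∈ walkVertices x w, G.IsLink e u v := by
  intro w
  induction w with
  | nil => simp [walkEdges]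
  | cons p w ih =>
    obtain ⟨f, v⟩ := p
    intro x h e he
    rcases List.mem_cons.1 he with rfl | he
    · exact ⟨x, by simp [walkVertices], v, by simp [walkVertices], h.1⟩
    · obtain ⟨u, hu, v', hv', hl⟩ := ih h.2 e he
      exact ⟨u, List.mem_cons_of_mem _ hu, v', List.mem_cons_of_mem _ hv', hl⟩

/-! ### A terminal-free cycle of a minimal graph is critical -/

section Minimal

variable [Fintype G.elements] [DecidableEq G.elements] {Q : Set α} {r : Q → ℕ}

/-- The elements of `G` that are terminals of requirement at least `k`. -/
def terminals (G : Graph α β) (r : Q → ℕ) (k : ℕ) : Set G.elements :=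
  {z | ∃ q : Q, k ≤ r q ∧ z.1 = Sum.inl q.1}

lemma IsVertexConnectedFor.le_order (hG : G.IsVertexConnectedFor Q r) {k : ℕ}
    (s : VertexSeparation G.incidenceGraph) (hs : s.Splits (terminals G r k)) : k ≤ s.order := by
  obtain ⟨⟨x, hx, q, hq, hxq⟩, y, hy, p, hp, hyp⟩ := hs
  have hne : q ≠ p := by
    rintro rfl
    exact s.disj x hx (Subtype.ext (hxq.trans hyp.symm) ▸ hy)
  exact (le_min hq hp).trans ((hG.2 q p hne).le_order s ⟨x, hx, hxq⟩ ⟨y, hy, hyp⟩)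

/-- Deleting `e` destroys the connection of some pair of terminals, and Menger's theorem gives a
separation through `e` whose order is at most the requirement of the pair. The paths present in G
give the reverse inequality. -/
lemma IsMinimalVertexConnectedFor.exists_tight (hG : G.IsMinimalVertexConnectedFor Q r)
    (hr : ∀ q, r q = 2 ∨ r q = 3) (e : G.elements) (he : e.1.isRight) :
    ∃ s : VertexSeparation G.incidenceGraph, e ∈ s.sep ∧
      s.Tight (terminals G r 2) (terminals G r 3) := by
  obtain ⟨e | e, he'⟩ := e
  · cases he
  have heG : e ∈ G.edgeSet := by simpa using he'
  have h := hG.2.1 e heG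
  have hQ := hG.1.1
  unfold IsVertexConnectedFor at h
  push Not at h
  obtain ⟨x, y, hxy, h⟩ := h (by simpa using hQ)
  obtain ⟨s, hx, hy, ⟨z, hz, hze⟩, hs⟩ := exists_separation (hQ x.2) (hQ y.2) heG
    (fun h => hxy (Subtype.ext h)) h
  obtain rfl : z = ⟨Sum.inr e, he'⟩ := Subtype.ext hze
  refine ⟨s, hz, ?_⟩
  have hle := (hG.1.2 x y hxy).le_order s hx hy
  obtain ⟨a, ha, hax⟩ := hx
  obtain ⟨b, hb, hby⟩ := hy
  have hx := hr x
  have hy := hr y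
  have split : ∀ k, k ≤ r x → k ≤ r y → s.Splits (terminals G r k) := fun k h1 h2 =>
    ⟨⟨a, ha, x, h1, hax⟩, b, hb, y, h2, hby⟩
  by_cases h3 : r x = 3 ∧ r y = 3
  · exact Or.inr ⟨by omega, split 3 h3.1.ge h3.2.ge⟩
  · exact Or.inl ⟨by omega, split 2 (by omega) (by omega)⟩

/-- An edge in a tight separator has a neighbour on each side, but a loop has only one neighbour in
the incidence graph. -/
lemma IsMinimalVertexConnectedFor.not_isLoopAt (hG : G.IsMinimalVertexConnectedFor Q r)
    (hr : ∀ q, r q = 2 ∨ r q = 3) {e : β} {x : α} : ¬ G.IsLoopAt e x := by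
  intro h
  obtain ⟨s, hs, hst⟩ := hG.exists_tight hr ⟨Sum.inr e, by simpa using h.edge_mem⟩ rfl
  have key : ∀ z : G.elements, G.incidenceGraph.Adj ⟨Sum.inr e, by simpa using h.edge_mem⟩ z →
      z.1 = Sum.inl x := by
    rintro ⟨z | z, hz⟩ hadj
    · exact congrArg Sum.inl (h.eq_of_inc hadj).symm
    · exact hadj.elim
  have : ∃ u ∈ s.left, ∃ v ∈ s.right, u.1 = Sum.inl x ∧ v.1 = Sum.inl x := by
    rcases hst with ⟨ho, hT⟩ | ⟨ho, hT⟩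
    all_goals
      obtain ⟨u, hu, hu'⟩ := VertexSeparation.exists_adj_left (fun t => hG.1.le_order t) hT ho hs
      obtain ⟨v, hv, hv'⟩ := VertexSeparation.exists_adj_right (fun t => hG.1.le_order t) hT ho hs
      exact ⟨u, hu, v, hv, key u hu', key v hv'⟩
  obtain ⟨u, hu, v, hv, hux, hvx⟩ := this
  exact s.disj u hu (Subtype.ext (hux.trans hvx.symm) ▸ hv)

/-- A cycle without terminals of a minimal `(Q, r)`-vertex-connected graph is a critical cycle of
the incidence graph. -/
lemma IsMinimalVertexConnectedFor.criticalCycle (hG : G.IsMinimalVertexConnectedFor Q r)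
    (hr : ∀ q, r q = 2 ∨ r q = 3) {x : α} {w : List (β × α)} (hw : G.IsCycleFrom x w)
    (hQ : ∀ v ∈ walkVertices x w, v ∉ Q) :
    CriticalCycle G.incidenceGraph {z | z.1.isRight} (terminals G r 2) (terminals G r 3)
      {z | z.1 ∈ walkElements w} := by
  obtain ⟨hww, hne, hne', hnv'⟩ := id hw
  have hnd := nodup_walkElements hne' hnv'
  have hvert : ∀ v, v ∈ walkVertices x w ↔ Sum.inl v ∈ walkElements w := by
    intro v
    rw [inl_mem_walkElements]
    constructor
    · intro h
      rcases List.mem_cons.1 h with rfl | h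
      · rw [← inl_mem_walkElements (β := β)]
        obtain ⟨l, hl⟩ := hww.exists_eq_append hne
        simp [hl]
      · exact h
    · exact fun h => List.mem_cons_of_mem _ h
  -- Without loops the cycle has at least two edges, so each of its vertices has two distinct edges
  -- of the cycle.
  have hlen : 4 ≤ (walkElements w).length := by
    rw [length_walkElements]
    rcases w with _ | ⟨⟨e, v⟩, _ | ⟨p, w⟩⟩
    · exact absurd rfl hne
    · obtain ⟨h1, rfl, -⟩ := hww
      exact absurd h1 (hG.not_isLoopAt hr)
    · simp only [List.length_cons]; omega
  refine ⟨?_, ?_, fun s => hG.1.le_order s, fun s => hG.1.le_order s, ?_, ?_, ?_, ?_,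
    fun e _ he => hG.exists_tight hr e he⟩
  · rintro ⟨a | a, ha⟩ ⟨b | b, hb⟩ h
    · exact h.elim
    · simp
    · simp
    · exact h.elim
  · rintro z ⟨q, hq, hz⟩
    exact ⟨q, by omega, hz⟩
  · rintro z hz ⟨q, -, hzq⟩
    refine hQ q.1 ((hvert _).2 ?_) q.2
    rw [← hzq]
    exact hz
  · rintro ⟨e | e, he⟩ heC heE
    · cases heE
    obtain ⟨u, hu, v, hv, hl⟩ := hww.exists_isLink e (inr_mem_walkElements.1 heC)
    refine ⟨⟨Sum.inl u, by simpa using hl.left_mem⟩, (hvert u).1 hu,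
      ⟨Sum.inl v, by simpa using hl.right_mem⟩, (hvert v).1 hv, ?_⟩
    rintro ⟨z | z, hz⟩
    · rw [incidenceGraph_adj]
      simp only [Subtype.mk.injEq, Sum.inl.injEq]
      constructor
      · exact fun h => Inc.eq_or_eq_of_isLink h hl
      · rintro (rfl | rfl)
        · exact hl.inc_left
        · exact hl.inc_right
    · simp only [Subtype.mk.injEq, reduceCtorEq, or_self, iff_false]
      exact id
  · intro v hv _ e
    obtain ⟨m, hm, hc⟩ := hw.exists_rotation hv
    have hml := hm.length_eq
    have hmn := (hm.nodup_iff.2 hnd).of_cons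
    rcases m with _ | ⟨a, m⟩
    · simp at hml; omega
    rcases List.eq_nil_or_concat m with rfl | ⟨m, b, rfl⟩
    · simp at hml; omega
    rw [List.concat_eq_append] at hm hc hmn
    have hab : a ≠ b := by
      rintro rfl
      simp at hmn
    have ha : a ∈ walkElements w := hm.subset (by simp)
    have hb : b ∈ walkElements w := hm.subset (by simp)
    have hva : G.IncAdj v.1 a := by
      rw [List.cons_append, List.isChain_cons_cons] at hc
      exact hc.1
    have hvb : G.IncAdj v.1 b := by
      have h1 : ([b, v.1] : List (α ⊕ β)).IsChain G.IncAdj := hc.suffix ⟨v.1 :: a :: m, by simp⟩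
      rw [List.isChain_cons_cons] at h1
      exact h1.1.symm
    by_cases hae : a = e.1
    · exact ⟨⟨b, hww.mem_elements b hb⟩, hb, fun h => hab (hae.trans (congrArg Subtype.val h).symm),
        hvb⟩
    · exact ⟨⟨a, hww.mem_elements a ha⟩, ha, fun h => hae (congrArg Subtype.val h), hva⟩
  · rintro z hz X ⟨a, haC, haX, haz⟩ ⟨b, hbC, hbX, hbz⟩
    obtain ⟨m, hm, hc⟩ := hw.exists_rotation hz
    have hc' : m.IsChain G.IncAdj := hc.infix ⟨[z.1], [z.1], by simp⟩
    have hmem : ∀ y : G.elements, y.1 ∈ walkElements w → y ≠ z → y.1 ∈ m := by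
      intro y hy hyz
      have := hm.mem_iff.2 hy
      rcases List.mem_cons.1 this with h | h
      · exact absurd (Subtype.ext h) hyz
      · exact h
    have hmz : z.1 ∉ m := (List.nodup_cons.1 (hm.nodup_iff.2 hnd)).1
    obtain ⟨c, hc, d, hd, ⟨hcG, hcX⟩, hdX, hcd⟩ := hc'.exists_crossing (fun _ _ h => h.symm)
      (P := fun y => ∃ h : y ∈ G.elements, ⟨y, h⟩ ∈ X) ⟨a.1, hmem a haC haz, a.2, haX⟩
      ⟨b.1, hmem b hbC hbz, fun h => hbX h.2⟩
    have hcw : c ∈ walkElements w := hm.subset (List.mem_cons_of_mem _ hc)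
    have hdw : d ∈ walkElements w := hm.subset (List.mem_cons_of_mem _ hd)
    exact ⟨⟨c, hcG⟩, hcw, ⟨d, hww.mem_elements d hdw⟩, hdw, hcX, fun h => hmz (h ▸ hc),
      fun h => hdX ⟨_, h⟩, fun h => hmz (h ▸ hd), hcd⟩

end Minimal

end Graph

theorem mainTheorem6 {α β : Type*} (G : Graph α β)
    (hV : G.vertexSet.Finite) (hE : G.edgeSet.Finite)
    (Q : Set α) (r : Q → ℕ) (hr : ∀ q, r q = 2 ∨ r q = 3)
    (hG : G.IsMinimalVertexConnectedFor Q r)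
    (x : α) (w : List (β × α)) (hw : G.IsCycleFrom x w) :
    ∃ v ∈ Graph.walkVertices x w, v ∈ Q := by
  classical
  by_contra! hQ
  have : Fintype G.elements := ((hV.image _).union (hE.image _)).fintype
  have hC := hG.criticalCycle hr hw hQ
  obtain ⟨hww, hne, -⟩ := hw
  obtain ⟨⟨e, v⟩, w, rfl⟩ := List.exists_cons_of_ne_nil hne
  have he : Sum.inr e ∈ Graph.walkElements ((e, v) :: w) := by simp [Graph.walkElements]
  exact hC.notMem_edges (e := ⟨Sum.inr e, hww.mem_elements _ he⟩) he rfl
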